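/- Let $L\ge 2$ be an even integer and let $\Gamma_L=\mathbb Z^2/L\mathbb Z^2$ be the square lattice with periodic boundary conditions, with edges $(x,\mu)=(x,x+e_\mu)$, $x\in\Gamma_L$, $\mu=1,2$. For a $\mathbb Z_2$ gauge field $\sigma=(\sigma_{x,\mu})$, $\sigma_{x,\mu}\in\{\pm1\}$, and $t>0$, let $$H_f(\sigma)=-t\sum_{x\in\Gamma_L}\sum_{\mu=1,2}\big(\sigma_{x,\mu}\,a^+_x a^-_{x+e_\mu}+\mathrm{h.c.}\big)$$ act on the fermionic Fock space $\mathcal F_L$ over $\ell^2(\Gamma_L)$, where $a^\pm_x$ are the fermionic creation and annihilation operators and $N=\sum_x a^+_xa^-_x$. For $\beta\ge 0$ define the even and odd partition functions (at half-filling) $$Z^+_{\beta,L}(\sigma)=\mathrm{Tr}_{\mathcal F_L}\,e^{-\beta H_f(\sigma)},\qquad Z^-_{\beta,L}(\sigma)=\mathrm{Tr}_{\mathcal F_L}\,(-1)^N e^{-\beta H_f(\sigma)},$$ which are real. The flux of $\sigma$ through a plaquette, or along one of two inequivalent non-contractible loops of the torus, is the product of the signs $\sigma_{x,\mu}$ over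 its edges ($+1$ means flux $0$ and $-1$ means flux $\pi$). **Theorem (Optimality of the $\pi$-flux phase).** There is a gauge field $\sigma_\pi$ with flux $\pi$ through every plaquette such that, for all $t>0$ and all $\beta\ge0$, $$\max_{\text{fluxes}}Z^{+}_{\beta,L}(\sigma)=Z^{+}_{\beta,L}(\sigma_\pi)\qquad\text{and}\qquad \max_{\text{fluxes}}Z^{-}_{\beta,L}(\sigma)=Z^{-}_{\beta,L}(\sigma_\pi),$$ where the maximum is over all the fluxes, through the plaquettes and along the non-contractible loops, of gauge fields $\sigma$ on $\Gamma_L$. -/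

import Mathlib

open scoped Matrix

namespace PiFlux

/-- The two-dimensional discrete torus `ℤ² / Lℤ²`. -/
abbrev Torus (L : ℕ) : Type := Fin 2 → ZMod L

/-- The unit vector in direction `μ`. -/
def e {L : ℕ} (μ : Fin 2) : Torus L := Pi.single μ 1

/-- A `ℤ₂` gauge field: a sign `σ x μ = ±1` on each edge `(x, x + e μ)`.  (For `L = 2` the edges
`(x, μ)` and `(x + e μ, μ)` have the same endpoints, but are distinct.) -/
abbrev GaugeField (L : ℕ) : Type := Torus L → Fin 2 → ℤˣ

/-- The flux through the elementary plaquette with corners `x, x + e 0, x + e 0 + e 1, x + e 1`,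
as the product of the four signs around it; `1` is flux `0` and `-1` is flux `π`. -/
def plaquetteFlux {L : ℕ} (σ : GaugeField L) (x : Torus L) : ℤˣ :=
  σ x 0 * σ (x + e 0) 1 * σ (x + e 1) 0 * σ x 1

/-- The flux along the non-contractible loop through the origin in direction `μ`. -/
def loopFlux {L : ℕ} [NeZero L] (σ : GaugeField L) (μ : Fin 2) : ℤˣ :=
  ∏ k : ZMod L, σ (Pi.single μ k) μ

/-- All the fluxes of a gauge field: through the plaquettes, and along two inequivalent
non-contractible loops of the torus. -/
def fluxes {L : ℕ} [NeZero L] (σ : GaugeField L) : (Torus L → ℤˣ) × (Fin 2 → ℤˣ) :=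
  (plaquetteFlux σ, loopFlux σ)

/-- The gauge field realizes the `π`-flux phase: there is flux `π` through every plaquette. -/
def IsPiFlux {L : ℕ} (σ : GaugeField L) : Prop :=
  ∀ x, plaquetteFlux σ x = -1

/-- Operators on the fermionic Fock space over `ℓ²(Torus L)`, as matrices in the orthonormal
occupation number basis; a basis vector is given by its set of occupied sites. -/
abbrev FockOp (L : ℕ) : Type := Matrix (Finset (Torus L)) (Finset (Torus L)) ℂ

/-- An enumeration of the sites, used to order the factors of the basis vectors. -/
def siteRank {L : ℕ} (x : Torus L) : ℕ := (x 0).val * L + (x 1).val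

/-- The sign `(-1)^(number of sites of S that precede x)`. -/
def jwSign {L : ℕ} (x : Torus L) (S : Finset (Torus L)) : ℂ :=
  (-1) ^ (S.filter fun y => siteRank y < siteRank x).card

/-- The annihilation operator `a⁻ x`, which maps the basis vector of `T` to `jwSign x T` times that
of `T.erase x` if `x ∈ T`, and to `0` otherwise. -/
def annihilate {L : ℕ} (x : Torus L) : FockOp L :=
  Matrix.of fun S T => if x ∈ T ∧ S = T.erase x then jwSign x T else 0

/-- The creation operator `a⁺ x`, the adjoint of `a⁻ x`. -/
def create {L : ℕ} (x : Torus L) : FockOp L := (annihilate x)ᴴ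

/-- The number operator `N`. -/
def number (L : ℕ) [NeZero L] : FockOp L := ∑ x : Torus L, create x * annihilate x

/-- The parity operator `(-1)^N`. -/
def parity (L : ℕ) : FockOp L := Matrix.diagonal fun S => (-1) ^ S.card

/-- The fermionic Hamiltonian
`H_f(σ) = -t ∑_x ∑_μ (a⁺ x σ(x,μ) a⁻ (x + e μ) + h.c.)`. -/
def hamiltonian {L : ℕ} [NeZero L] (t : ℝ) (σ : GaugeField L) : FockOp L :=
  (-t : ℂ) • ∑ x : Torus L, ∑ μ : Fin 2,
    (((σ x μ : ℤ) : ℂ) • (create x * annihilate (x + e μ)) +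
      (((σ x μ : ℤ) : ℂ) • (create x * annihilate (x + e μ)))ᴴ)

/-- The trace `Tr e^{-β H_f(σ)}`. -/
noncomputable def evenTrace {L : ℕ} [NeZero L] (t β : ℝ) (σ : GaugeField L) : ℂ :=
  (NormedSpace.exp ((-β : ℂ) • hamiltonian t σ)).trace

/-- The trace `Tr (-1)^N e^{-β H_f(σ)}`. -/
noncomputable def oddTrace {L : ℕ} [NeZero L] (t β : ℝ) (σ : GaugeField L) : ℂ :=
  (parity L * NormedSpace.exp ((-β : ℂ) • hamiltonian t σ)).trace

/-- The even partition function, as a real number (the trace is real, see `ofReal_evenZ`). -/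
noncomputable def evenZ {L : ℕ} [NeZero L] (t β : ℝ) (σ : GaugeField L) : ℝ :=
  (evenTrace t β σ).re

/-- The odd partition function, as a real number (the trace is real, see `ofReal_oddZ`). -/
noncomputable def oddZ {L : ℕ} [NeZero L] (t β : ℝ) (σ : GaugeField L) : ℝ :=
  (oddTrace t β σ).re

/-- The values that a function `Z` of the gauge field takes over all flux configurations
(plaquette fluxes and loop fluxes of some gauge field). -/
def valuesOverFluxes {L : ℕ} [NeZero L] (Z : GaugeField L → ℝ) : Set ℝ :=
  {z | ∃ Φ : (Torus L → ℤˣ) × (Fin 2 → ℤˣ), ∃ σ : GaugeField L, fluxes σ = Φ ∧ Z σ = z}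

/-! The operators above are the standard ones. -/

theorem siteRank_injective {L : ℕ} [NeZero L] :
    Function.Injective (siteRank : Torus L → ℕ) := by
  intro x y h
  have h0 := ZMod.val_lt (x 1)
  have h1 := ZMod.val_lt (y 1)
  have hL : 0 < L := Nat.pos_of_ne_zero (NeZero.ne L)
  unfold siteRank at h
  have e0 : (x 0).val = (y 0).val := by
    have := congrArg (· / L) h
    simpa [Nat.mul_comm _ L, Nat.mul_add_div hL, Nat.div_eq_of_lt h0, Nat.div_eq_of_lt h1]
      using this
  have e1 : (x 1).val = (y 1).val := by
    rw [e0] at h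
    omega
  funext i
  fin_cases i
  · exact ZMod.val_injective L e0
  · exact ZMod.val_injective L e1

theorem jwSign_insert {L : ℕ} {x y : Torus L} {S : Finset (Torus L)} (hy : y ∉ S) :
    jwSign x (insert y S) = if siteRank y < siteRank x then -jwSign x S else jwSign x S := by
  unfold jwSign
  rw [Finset.filter_insert]
  split_ifs with h
  · rw [Finset.card_insert_of_notMem (by simp [hy]), pow_succ]
    ring
  · rfl

theorem jwSign_mul_self {L : ℕ} (x : Torus L) (S : Finset (Torus L)) :
    jwSign x S * jwSign x S = 1 := by
  unfold jwSign
  rw [← mul_pow]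
  simp

theorem annihilate_mul_apply {L : ℕ} [NeZero L] (x : Torus L) (M : FockOp L)
    (S T : Finset (Torus L)) :
    (annihilate x * M) S T = if x ∈ S then 0 else jwSign x S * M (insert x S) T := by
  rw [Matrix.mul_apply]
  split_ifs with h
  · refine Finset.sum_eq_zero fun U _ => ?_
    rw [annihilate, Matrix.of_apply, if_neg, zero_mul]
    rintro ⟨-, rfl⟩
    simp at h
  · rw [Finset.sum_eq_single (insert x S)]
    · rw [annihilate, Matrix.of_apply, if_pos, jwSign_insert h, if_neg (lt_irrefl _)]
      simp [h]
    · intro U _ hU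
      rw [annihilate, Matrix.of_apply, if_neg, zero_mul]
      rintro ⟨hx, rfl⟩
      exact hU (Finset.insert_erase hx).symm
    · simp

theorem create_mul_apply {L : ℕ} [NeZero L] (x : Torus L) (M : FockOp L)
    (S T : Finset (Torus L)) :
    (create x * M) S T = if x ∈ S then jwSign x S * M (S.erase x) T else 0 := by
  have hs : star (jwSign x S) = jwSign x S := by simp [jwSign]
  have hc : ∀ U, create x S U = if x ∈ S ∧ U = S.erase x then jwSign x S else 0 := by
    intro U
    rw [create, Matrix.conjTranspose_apply, annihilate, Matrix.of_apply]
    split_ifs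
    · exact hs
    · simp
  rw [Matrix.mul_apply]
  simp only [hc]
  split_ifs with h
  · simp [h]
  · simp [h]

/-- The anticommutation relation `{a⁻ x, a⁻ y} = 0`. -/
theorem annihilate_anticomm {L : ℕ} [NeZero L] (x y : Torus L) :
    annihilate x * annihilate y + annihilate y * annihilate x = 0 := by
  ext S T
  rw [Matrix.add_apply, annihilate_mul_apply, annihilate_mul_apply]
  rw [← mul_one (annihilate x), ← mul_one (annihilate y), annihilate_mul_apply,
    annihilate_mul_apply]
  rcases eq_or_ne x y with rfl | hxy
  · simp
  have hr : siteRank x ≠ siteRank y := fun h => hxy (siteRank_injective h)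
  by_cases hx : x ∈ S
  · simp [hx]
  by_cases hy : y ∈ S
  · simp [hy]
  simp only [hx, hy, hxy, hxy.symm, Finset.mem_insert, if_false, or_self, Matrix.zero_apply]
  rw [jwSign_insert hx, jwSign_insert hy, Finset.insert_comm]
  rcases lt_or_gt_of_ne hr with h | h
  · rw [if_pos h, if_neg h.le.not_gt]; ring
  · rw [if_pos h, if_neg h.le.not_gt]; ring

/-- The anticommutation relation `{a⁺ x, a⁺ y} = 0`. -/
theorem create_anticomm {L : ℕ} [NeZero L] (x y : Torus L) :
    create x * create y + create y * create x = 0 := by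
  simp only [create]
  rw [← Matrix.conjTranspose_mul, ← Matrix.conjTranspose_mul, ← Matrix.conjTranspose_add,
    annihilate_anticomm, Matrix.conjTranspose_zero]

/-- The anticommutation relation `{a⁺ x, a⁻ y} = δ_{x,y}`. -/
theorem create_annihilate_anticomm {L : ℕ} [NeZero L] (x y : Torus L) :
    create x * annihilate y + annihilate y * create x = if x = y then 1 else 0 := by
  ext S T
  rw [Matrix.add_apply, annihilate_mul_apply, create_mul_apply]
  rw [← mul_one (create x), ← mul_one (annihilate y), annihilate_mul_apply, create_mul_apply]
  rcases eq_or_ne x y with rfl | hxy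
  · by_cases hx : x ∈ S
    · have h1 : jwSign x S = jwSign x (S.erase x) := by
        conv_lhs => rw [← Finset.insert_erase hx]
        rw [jwSign_insert (by simp), if_neg (lt_irrefl _)]
      simp only [hx, Finset.mem_erase, ne_eq, not_true, false_and, if_true, if_false,
        add_zero]
      rw [h1, ← mul_assoc, jwSign_mul_self, one_mul, Finset.insert_erase hx]
    · simp only [hx, if_false, if_true, Finset.mem_insert, true_or, zero_add]
      rw [jwSign_insert hx, if_neg (lt_irrefl _), ← mul_assoc, jwSign_mul_self, one_mul,
        Finset.erase_insert hx]
  have hr : siteRank x ≠ siteRank y := fun h => hxy (siteRank_injective h)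
  by_cases hx : x ∈ S
  · by_cases hy : y ∈ S
    · simp [hx, hy, hxy, hxy.symm]
    obtain ⟨R, hxR, rfl⟩ : ∃ R, x ∉ R ∧ S = insert x R :=
      ⟨S.erase x, by simp, (Finset.insert_erase hx).symm⟩
    have hyR : y ∉ R := fun h => hy (Finset.mem_insert_of_mem h)
    have hxy' : x ∉ insert y R := by simp [hxy, hxR]
    simp only [hx, hy, hxy, Finset.mem_insert, or_true, if_true, if_false,
      Finset.erase_insert hxR, hyR, Matrix.zero_apply]
    rw [Finset.insert_comm, Finset.erase_insert hxy', Finset.erase_insert hxR, jwSign_insert hxy', jwSign_insert hxR, jwSign_insert hxR,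
      jwSign_insert hyR]
    simp only [lt_irrefl, if_false]
    rcases lt_or_gt_of_ne hr with h | h
    · rw [if_pos h, if_neg h.le.not_gt]; ring
    · rw [if_pos h, if_neg h.le.not_gt]; ring
  · simp [hx, hxy]

/-- The vacuum, i.e. the basis vector of `∅`, is annihilated by every `a⁻ x`. -/
theorem annihilate_vacuum {L : ℕ} (x : Torus L) (S : Finset (Torus L)) :
    annihilate x S ∅ = 0 := by
  simp [annihilate]

/-- The number operator counts the occupied sites, so that `parity` is `(-1)^N`. -/
theorem number_eq_diagonal (L : ℕ) [NeZero L] :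
    number L = Matrix.diagonal fun S => (S.card : ℂ) := by
  ext S T
  rw [number, Matrix.sum_apply]
  have h : ∀ x : Torus L, (create x * annihilate x) S T =
      if x ∈ S then (1 : FockOp L) S T else 0 := by
    intro x
    rw [create_mul_apply, ← mul_one (annihilate x), annihilate_mul_apply]
    split_ifs with hx hx'
    · simp at hx'
    · have h1 : jwSign x S = jwSign x (S.erase x) := by
        conv_lhs => rw [← Finset.insert_erase hx]
        rw [jwSign_insert (by simp), if_neg (lt_irrefl _)]
      rw [h1, ← mul_assoc, jwSign_mul_self, one_mul, Finset.insert_erase hx]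
    · rfl
  simp only [h]
  rw [Matrix.diagonal_apply, Matrix.one_apply]
  split_ifs <;> simp

theorem hamiltonian_isHermitian {L : ℕ} [NeZero L] (t : ℝ) (σ : GaugeField L) :
    (hamiltonian t σ).IsHermitian := by
  unfold hamiltonian Matrix.IsHermitian
  rw [Matrix.conjTranspose_smul, Matrix.conjTranspose_sum]
  congr 1
  · simp
  refine Finset.sum_congr rfl fun x _ => ?_
  rw [Matrix.conjTranspose_sum]
  refine Finset.sum_congr rfl fun μ _ => ?_
  rw [Matrix.conjTranspose_add, Matrix.conjTranspose_conjTranspose, add_comm]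

theorem exp_isHermitian {L : ℕ} [NeZero L] (t β : ℝ) (σ : GaugeField L) :
    (NormedSpace.exp ((-β : ℂ) • hamiltonian t σ)).IsHermitian := by
  apply Matrix.IsHermitian.exp
  unfold Matrix.IsHermitian
  rw [Matrix.conjTranspose_smul, hamiltonian_isHermitian]
  simp

theorem ofReal_evenZ {L : ℕ} [NeZero L] (t β : ℝ) (σ : GaugeField L) :
    (evenZ t β σ : ℂ) = evenTrace t β σ := by
  refine Complex.conj_eq_iff_re.1 ?_
  unfold evenTrace
  rw [starRingEnd_apply, ← Matrix.trace_conjTranspose, exp_isHermitian]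

theorem ofReal_oddZ {L : ℕ} [NeZero L] (t β : ℝ) (σ : GaugeField L) :
    (oddZ t β σ : ℂ) = oddTrace t β σ := by
  have hp : (parity L)ᴴ = parity L := by
    rw [parity, Matrix.diagonal_conjTranspose]
    congr 1
    funext S
    simp
  refine Complex.conj_eq_iff_re.1 ?_
  unfold oddTrace
  rw [starRingEnd_apply, ← Matrix.trace_conjTranspose, Matrix.conjTranspose_mul,
    exp_isHermitian, hp, Matrix.trace_mul_comm]

end PiFlux

/-! The proof is reflection positivity in the manner of Lieb, followed by an argument on maximizers.

Cut the torus by a pair of parallel planes into two halves that are mirror images. Apply a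
particle-hole transformation on the right half and realize the fermions on a tensor square, left
sites on the first factor and right sites on the second. By `Reflection.hop_eq_coupled` the exponent
becomes `A ⊗ 1 + 1 ⊗ B + ∑ C i ⊗ D i` with real matrices, where each cut edge contributes the same
operators, up to scalars, in both factors. Expanding the exponential by a product formula turns the
trace into a limit of sums of products of one-sided traces. Cauchy–Schwarz
(`trace_exp_coupled_sq_le`) then bounds its square by the product of the two symmetrized traces;
this is `Reflection.partition_sq_le`. The particle-hole transformation reverses the sign of the
hopping on the right, so symmetrizing means reflecting a half with a minus sign and making the cut
edges positive.

The tensor square is another representation of the anticommutation relations. Normalized traces of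
words in the generators are determined by these relations and by a grading operator
(`trace_adjoin_eq_zero`, `IsCAR.trace_exp_hop_eq`). This transfers the inequality back to Fock
space, and also gives gauge invariance.

Hence reflecting the left half of a maximizer gives a maximizer (`IsMaximizer.gaugeLeft`). The
reflected field has flux `π` through every plaquette met by the planes, since its two cut edges are
positive and the other two have opposite signs. Moving the plane one column at a time produces a
maximizer with flux `π` on half of the torus, and one more reflection extends this to the whole
torus. Reflections in both directions also force the loop fluxes. The resulting flux configuration
`optimalFluxes` depends neither on the temperature nor on the parity, and the partition functions
depend on the fluxes alone (`partition_eq_of_fluxes_eq`), so one field is optimal in all cases. -/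

namespace PiFlux

open Filter Topology

/-! ### Uniqueness of the trace under Clifford-type relations -/

section TraceUniqueness

variable {A J : Type*} [Ring A]

theorem word_anticomm {g : J → A} {P : A} (hPg : ∀ i, P * g i = -(g i * P)) (w : List J) :
    P * (w.map g).prod = (-1) ^ w.length * ((w.map g).prod * P) := by
  induction w with
  | nil => simp
  | cons i w ih =>
    rw [List.map_cons, List.prod_cons, ← mul_assoc, hPg, List.length_cons, pow_succ, neg_mul,
      mul_assoc, ih]
    have : g i * ((-1) ^ w.length * ((w.map g).prod * P)) =
        (-1) ^ w.length * (g i * ((w.map g).prod * P)) := by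
      rw [← mul_assoc, ((Commute.neg_one_right (g i)).pow_right w.length).eq, mul_assoc]
    rw [this]
    noncomm_ring

variable [Algebra ℝ A]

/-- The generators `g` satisfy Clifford-type relations: their anticommutators are the scalars
`B i j`. -/
def CliffordRel (B : J → J → ℝ) (g : J → A) : Prop :=
  ∀ i j, g i * g j + g j * g i = algebraMap ℝ A (B i j)

/-- Moving a generator to the left through a word, modulo shorter words. -/
theorem trace_word_move {B : J → J → ℝ} {g : J → A} (hg : CliffordRel B g) (τ : A →ₗ[ℝ] ℝ)
    {N : ℕ} (hN : ∀ w : List J, w.length < N → τ (w.map g).prod = 0) (i : J) (v : List J) :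
    ∀ u : List J, u.length + v.length + 1 = N →
      τ ((u.map g).prod * ((v.map g).prod * g i)) =
        (-1) ^ v.length * τ ((u.map g).prod * (g i * (v.map g).prod)) := by
  induction v with
  | nil => intro u _; simp
  | cons j v ih =>
    intro u hu
    have h1 := ih (u ++ [j]) (by simp at hu ⊢; omega)
    have h2 := hN (u ++ v) (by simp at hu ⊢; omega)
    have h3 : g j * g i = algebraMap ℝ A (B j i) - g i * g j := by
      rw [← hg j i]; abel
    rw [List.map_append, List.prod_append, List.map_singleton, List.prod_singleton] at h1
    rw [List.map_append, List.prod_append] at h2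
    rw [List.map_cons, List.prod_cons]
    rw [show (u.map g).prod * (g j * (v.map g).prod * g i) =
      (u.map g).prod * g j * ((v.map g).prod * g i) by noncomm_ring, h1]
    rw [show (u.map g).prod * g j * (g i * (v.map g).prod) =
      (u.map g).prod * ((g j * g i) * (v.map g).prod) by noncomm_ring, h3]
    rw [sub_mul, mul_sub, map_sub, ← Algebra.smul_def, mul_smul_comm, map_smul, h2, smul_zero,
      zero_sub, List.length_cons, pow_succ, ← mul_assoc (g i)]
    ring

/-- Induction on the length. In a nonempty even word, moving the first letter to the end by
cyclicity and back by anticommutation costs an odd number of signs, so the trace equals its own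
negative up to shorter words. An odd word anticommutes with `P`. -/
theorem trace_word_eq_zero {B : J → J → ℝ} {g : J → A} (hg : CliffordRel B g) (τ : A →ₗ[ℝ] ℝ)
    (hτ : ∀ x y, τ (x * y) = τ (y * x)) (h1 : τ 1 = 0) {P : A} (hPP : P * P = 1)
    (hPg : ∀ i, P * g i = -(g i * P)) (w : List J) : τ (w.map g).prod = 0 := by
  induction hn : w.length using Nat.strong_induction_on generalizing w with
  | _ N ih =>
    rcases Nat.even_or_odd N with hN | hN
    · rcases w with _ | ⟨i, v⟩
      · simpa using h1
      · have h := trace_word_move hg τ (N := N) (fun w hw => ih _ hw w rfl) i v []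
          (by simpa using hn)
        have hv : Odd v.length := by
          rw [List.length_cons] at hn
          rw [← hn] at hN
          exact Nat.not_even_iff_odd.1 fun h => by
            rw [Nat.even_add_one] at hN; exact hN h
        rw [hv.neg_one_pow] at h
        simp only [List.map_nil, List.prod_nil, one_mul] at h
        rw [hτ] at h
        rw [List.map_cons, List.prod_cons]
        linear_combination h / 2
    · have h2 : τ (w.map g).prod = τ (P * (w.map g).prod * P) := by
        rw [hτ, ← mul_assoc, hPP, one_mul]
      rw [word_anticomm hPg, hn, hN.neg_one_pow, mul_assoc, mul_assoc, hPP, mul_one, neg_one_mul,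
        map_neg] at h2
      linear_combination h2 / 2

theorem trace_adjoin_eq_zero {B : J → J → ℝ} {g : J → A} (hg : CliffordRel B g) (τ : A →ₗ[ℝ] ℝ)
    (hτ : ∀ x y, τ (x * y) = τ (y * x)) (h1 : τ 1 = 0) {P : A} (hPP : P * P = 1)
    (hPg : ∀ i, P * g i = -(g i * P)) {X : A} (hX : X ∈ Algebra.adjoin ℝ (Set.range g)) :
    τ X = 0 := by
  rw [← Subalgebra.mem_toSubmodule, Algebra.adjoin_eq_span] at hX
  induction hX using Submodule.span_induction with
  | mem x hx =>
    obtain ⟨l, hl, rfl⟩ := Submonoid.exists_list_of_mem_closure hx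
    obtain ⟨w, rfl⟩ : ∃ w : List J, w.map g = l := by
      have h : l ∈ Set.range (List.map g) := by rw [Set.range_list_map]; exact hl
      exact h
    exact trace_word_eq_zero hg τ hτ h1 hPP hPg w
  | zero => simp
  | add x y _ _ hx hy => rw [map_add, hx, hy, add_zero]
  | smul c x _ hx => rw [map_smul, hx, smul_zero]

end TraceUniqueness

/-! ### A product formula for the exponential with a second-order error -/

section ExpLimit

variable {𝔸 : Type*} [NormedRing 𝔸]

/-- Telescoping, one factor at a time. The extra factor `C` on the left avoids the exponent `n - 1`.
-/
theorem norm_pow_sub_pow_le_of_norm_le [NormOneClass 𝔸] {x y : 𝔸} {C : ℝ} (hx : ‖x‖ ≤ C)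
    (hy : ‖y‖ ≤ C) (n : ℕ) : ‖x ^ n - y ^ n‖ * C ≤ n * C ^ n * ‖x - y‖ := by
  have hC : 0 ≤ C := (norm_nonneg x).trans hx
  induction n with
  | zero => simp
  | succ n ih =>
    have h : x ^ (n + 1) - y ^ (n + 1) = x ^ n * (x - y) + (x ^ n - y ^ n) * y := by
      rw [pow_succ, pow_succ]; noncomm_ring
    have h1 : ‖x ^ n * (x - y)‖ ≤ C ^ n * ‖x - y‖ :=
      (norm_mul_le _ _).trans (mul_le_mul_of_nonneg_right
        ((norm_pow_le _ _).trans (pow_le_pow_left₀ (norm_nonneg _) hx n)) (norm_nonneg _))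
    have h2 : ‖(x ^ n - y ^ n) * y‖ ≤ ‖x ^ n - y ^ n‖ * C :=
      (norm_mul_le _ _).trans (mul_le_mul_of_nonneg_left hy (norm_nonneg _))
    calc ‖x ^ (n + 1) - y ^ (n + 1)‖ * C
        ≤ (C ^ n * ‖x - y‖ + n * C ^ n * ‖x - y‖) * C := by
          gcongr
          rw [h]
          exact (norm_add_le _ _).trans (add_le_add h1 (h2.trans ih))
      _ = ((n + 1 : ℕ) : ℝ) * C ^ (n + 1) * ‖x - y‖ := by push_cast; ring

variable [NormedAlgebra ℝ 𝔸]

theorem norm_exp_le_exp_norm [NormOneClass 𝔸] [CompleteSpace 𝔸] (x : 𝔸) :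
    ‖NormedSpace.exp x‖ ≤ Real.exp ‖x‖ := by
  have h := NormedSpace.exp_series_hasSum_exp' (𝕂 := ℝ) ‖x‖
  rw [← Real.exp_eq_exp_ℝ] at h
  rw [← (NormedSpace.exp_series_hasSum_exp' (𝕂 := ℝ) x).tsum_eq]
  refine tsum_of_norm_bounded h fun n => ?_
  rw [norm_smul, Real.norm_of_nonneg (by positivity), smul_eq_mul]
  gcongr
  exact norm_pow_le x n

/-- `(1 + M / n + E / n²) ^ n → exp M`. -/
theorem tendsto_one_add_pow_exp [NormOneClass 𝔸] [CompleteSpace 𝔸] (M E : 𝔸) :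
    Tendsto (fun n : ℕ => (1 + ((n : ℝ)⁻¹) • M + ((n : ℝ)⁻¹ ^ 2) • E) ^ n) atTop
      (𝓝 (NormedSpace.exp M)) := by
  set c : ℝ := ‖M‖ + ‖E‖
  have hc : 0 ≤ c := by positivity
  have hexp : ∀ n : ℕ, n ≠ 0 → NormedSpace.exp ((n : ℝ)⁻¹ • M) ^ n = NormedSpace.exp M := by
    intro n hn
    let _ : NormedAlgebra ℚ 𝔸 := NormedAlgebra.restrictScalars ℚ ℝ 𝔸
    rw [← NormedSpace.exp_nsmul, ← Nat.cast_smul_eq_nsmul ℝ, smul_smul,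
      mul_inv_cancel₀ (by positivity), one_smul]
  have hinv : Tendsto (fun n : ℕ => (n : ℝ)⁻¹) atTop (𝓝 0) := tendsto_inv_atTop_nhds_zero_nat
  -- the error in one step is `o(1 / n)`
  have hstep : Tendsto (fun n : ℕ => (n : ℝ) * ‖(1 + ((n : ℝ)⁻¹) • M + ((n : ℝ)⁻¹ ^ 2) • E) -
      NormedSpace.exp ((n : ℝ)⁻¹ • M)‖) atTop (𝓝 0) := by
    -- The `o(1/n)` estimate is differentiability of `s ↦ exp (s • M)` at `0`, read along `s = 1/n`;
    -- the `E` term is itself `O(1/n²)`.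
    have hd := hasDerivAt_exp_smul_const (𝕂 := ℝ) M (0 : ℝ)
    rw [hasDerivAt_iff_tendsto_slope] at hd
    have hne : Tendsto (fun n : ℕ => (n : ℝ)⁻¹) atTop (𝓝[≠] 0) := by
      rw [tendsto_nhdsWithin_iff]
      refine ⟨hinv, ?_⟩
      filter_upwards [eventually_ne_atTop 0] with n hn
      simpa using hn
    have h1 := hd.comp hne
    have h2 := ((h1.sub_const M).sub (hinv.smul_const E)).norm
    simp only [zero_smul, NormedSpace.exp_zero, one_mul, sub_self, norm_zero] at h2
    refine h2.congr' ?_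
    filter_upwards [eventually_ne_atTop 0] with n hn
    have hn' : (n : ℝ) ≠ 0 := by exact_mod_cast hn
    rw [← Real.norm_natCast n, ← norm_smul, ← norm_neg]
    congr 1
    simp only [Function.comp_apply, slope_def_module, Real.norm_natCast, zero_smul,
      NormedSpace.exp_zero, sub_zero, inv_inv, smul_sub, smul_add, smul_smul]
    rw [mul_inv_cancel₀ hn', one_smul,
      show (n : ℝ) * (n : ℝ)⁻¹ ^ 2 = (n : ℝ)⁻¹ by field_simp]
    abel
  -- Both the approximate step and the exact one have norm at most `exp (c / n)`, so their `n`-th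
  -- powers differ by at most `exp c` times `n` times the one-step error.
  have hbound : ∀ n : ℕ, n ≠ 0 →
      ‖(1 + ((n : ℝ)⁻¹) • M + ((n : ℝ)⁻¹ ^ 2) • E) ^ n - NormedSpace.exp M‖ ≤
        Real.exp c * (n * ‖(1 + ((n : ℝ)⁻¹) • M + ((n : ℝ)⁻¹ ^ 2) • E) -
      NormedSpace.exp ((n : ℝ)⁻¹ • M)‖) := by
    intro n hn
    have hn' : (0 : ℝ) < n := by positivity
    have hn1 : (1 : ℝ) ≤ n := by exact_mod_cast Nat.one_le_iff_ne_zero.2 hn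
    have hi0 : (0 : ℝ) ≤ (n : ℝ)⁻¹ := by positivity
    have hi1 : (n : ℝ)⁻¹ ≤ 1 := inv_le_one_of_one_le₀ hn1
    have hx : ‖1 + ((n : ℝ)⁻¹) • M + ((n : ℝ)⁻¹ ^ 2) • E‖ ≤ Real.exp ((n : ℝ)⁻¹ * c) := by
      calc _ ≤ 1 + (n : ℝ)⁻¹ * ‖M‖ + (n : ℝ)⁻¹ ^ 2 * ‖E‖ := by
            refine (norm_add₃_le).trans ?_
            rw [norm_one, norm_smul, norm_smul, Real.norm_of_nonneg hi0,
              Real.norm_of_nonneg (by positivity)]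
        _ ≤ 1 + (n : ℝ)⁻¹ * ‖M‖ + (n : ℝ)⁻¹ * ‖E‖ := by
            gcongr
            nlinarith
        _ = (n : ℝ)⁻¹ * c + 1 := by ring
        _ ≤ _ := Real.add_one_le_exp _
    have hy : ‖NormedSpace.exp ((n : ℝ)⁻¹ • M)‖ ≤ Real.exp ((n : ℝ)⁻¹ * c) := by
      refine (norm_exp_le_exp_norm _).trans ?_
      rw [Real.exp_le_exp, norm_smul, Real.norm_of_nonneg hi0]
      gcongr
      exact le_add_of_nonneg_right (norm_nonneg _)
    have h := norm_pow_sub_pow_le_of_norm_le hx hy n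
    rw [hexp n hn, ← Real.exp_nat_mul, ← mul_assoc, mul_inv_cancel₀ hn'.ne', one_mul] at h
    have h1 : 1 ≤ Real.exp ((n : ℝ)⁻¹ * c) := Real.one_le_exp (by positivity)
    calc _ ≤ ‖(1 + ((n : ℝ)⁻¹) • M + ((n : ℝ)⁻¹ ^ 2) • E) ^ n - NormedSpace.exp M‖ *
          Real.exp ((n : ℝ)⁻¹ * c) := le_mul_of_one_le_right (norm_nonneg _) h1
      _ ≤ _ := h
      _ = _ := by ring
  rw [tendsto_iff_norm_sub_tendsto_zero]
  refine squeeze_zero' (Eventually.of_forall fun _ => norm_nonneg _)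
    ((eventually_ne_atTop 0).mono hbound) ?_
  simpa using hstep.const_mul (Real.exp c)

end ExpLimit

end PiFlux

namespace PiFlux

open Filter Topology
open scoped Kronecker

/-! ### Reflection positivity on a tensor square -/

section ReflectionPositivity

open scoped Matrix.Norms.Operator

variable {n I : Type*} [Fintype n] [DecidableEq n] [Fintype I]

theorem hasSum_trace_mul_exp (Q X : Matrix n n ℝ) :
    HasSum (fun k : ℕ => (k.factorial : ℝ)⁻¹ * (Q * X ^ k).trace)
      (Q * NormedSpace.exp X).trace := by
  have h := NormedSpace.exp_series_hasSum_exp' (𝕂 := ℝ) X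
  have hc : Continuous fun Y : Matrix n n ℝ => (Q * Y).trace := by fun_prop
  have := h.map ((Matrix.traceAddMonoidHom n ℝ).comp (AddMonoidHom.mulLeft Q)) hc
  refine this.congr_fun ?_
  intro k
  simp

theorem sum_kronecker_pow (X Y : I → Matrix n n ℝ) (k : ℕ) :
    (∑ i, X i ⊗ₖ Y i) ^ k = ∑ w : Fin k → I,
      (List.ofFn fun j => X (w j)).prod ⊗ₖ (List.ofFn fun j => Y (w j)).prod := by
  induction k with
  | zero => simp
  | succ k ih =>
    rw [pow_succ', ih, Finset.sum_mul_sum, ← Fintype.sum_prod_type',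
      ← Fintype.sum_equiv (Fin.consEquiv fun _ => I) _ _ fun _ => rfl]
    refine Finset.sum_congr rfl fun q _ => ?_
    rw [← Matrix.mul_kronecker_mul]
    simp [Fin.consEquiv, List.ofFn_succ]

theorem trace_sum_kronecker_pow (Q : Matrix n n ℝ) (X Y : I → Matrix n n ℝ) (k : ℕ) :
    ((Q ⊗ₖ Q) * (∑ i, X i ⊗ₖ Y i) ^ k).trace = ∑ w : Fin k → I,
      (Q * (List.ofFn fun j => X (w j)).prod).trace *
        (Q * (List.ofFn fun j => Y (w j)).prod).trace := by
  rw [sum_kronecker_pow, Finset.mul_sum, Matrix.trace_sum]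
  refine Finset.sum_congr rfl fun w _ => ?_
  rw [← Matrix.mul_kronecker_mul, Matrix.trace_kronecker]

theorem trace_sum_kronecker_pow_nonneg (Q : Matrix n n ℝ) (X : I → Matrix n n ℝ) (k : ℕ) :
    0 ≤ ((Q ⊗ₖ Q) * (∑ i, X i ⊗ₖ X i) ^ k).trace := by
  rw [trace_sum_kronecker_pow]
  exact Finset.sum_nonneg fun _ _ => mul_self_nonneg _

/-- The trace of a Kronecker product factorizes, so the left side is a sum over words of a function
of `X` times the same function of `Y`: Cauchy–Schwarz for finite real sums applies. -/
theorem trace_sum_kronecker_pow_sq_le (Q : Matrix n n ℝ) (X Y : I → Matrix n n ℝ) (k : ℕ) :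
    ((Q ⊗ₖ Q) * (∑ i, X i ⊗ₖ Y i) ^ k).trace ^ 2 ≤
      ((Q ⊗ₖ Q) * (∑ i, X i ⊗ₖ X i) ^ k).trace * ((Q ⊗ₖ Q) * (∑ i, Y i ⊗ₖ Y i) ^ k).trace := by
  simp only [trace_sum_kronecker_pow, ← pow_two]
  exact Finset.sum_mul_sq_le_sq_mul_sq _ _ _

/-- The factors of one step in the product formula for
`exp (A ⊗ 1 + 1 ⊗ B + ∑ i, C i ⊗ D i)`. -/
noncomputable def stepFactor (A : Matrix n n ℝ) (C : I → Matrix n n ℝ) (k : ℕ) :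
    Option I → Matrix n n ℝ
  | none => 1 + (k : ℝ)⁻¹ • A
  | some i => √((k : ℝ)⁻¹) • C i

/-- The generator `A ⊗ 1 + 1 ⊗ B + ∑ i, C i ⊗ D i`. -/
def coupled (A B : Matrix n n ℝ) (C D : I → Matrix n n ℝ) : Matrix (n × n) (n × n) ℝ :=
  A ⊗ₖ 1 + 1 ⊗ₖ B + ∑ i, C i ⊗ₖ D i

/-- Each step is a sum of Kronecker products in which the left factors involve only `A, C` and the
right factors only `B, D`. The price of the factorized form is the surplus `A ⊗ₖ B` at order `k⁻²`,
which disappears in the limit. -/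
theorem sum_stepFactor {n : Type*} [DecidableEq n] (A B : Matrix n n ℝ) (C D : I → Matrix n n ℝ) (k : ℕ) :
    ∑ i, stepFactor A C k i ⊗ₖ stepFactor B D k i =
      1 + (k : ℝ)⁻¹ • coupled A B C D + ((k : ℝ)⁻¹ ^ 2) • (A ⊗ₖ B) := by
  rw [Fintype.sum_option]
  simp only [stepFactor, coupled, Matrix.smul_kronecker, Matrix.kronecker_smul, smul_smul,
    Matrix.add_kronecker, Matrix.kronecker_add, Matrix.one_kronecker_one,
    Real.mul_self_sqrt (inv_nonneg.2 (Nat.cast_nonneg (α := ℝ) k)), smul_add, Finset.smul_sum,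
    pow_two]
  abel

theorem tendsto_trace_stepFactor [Nonempty n] (Q A B : Matrix n n ℝ) (C D : I → Matrix n n ℝ) :
    Tendsto (fun k : ℕ => ((Q ⊗ₖ Q) *
      (∑ i, stepFactor A C k i ⊗ₖ stepFactor B D k i) ^ k).trace) atTop
      (𝓝 ((Q ⊗ₖ Q) * NormedSpace.exp (coupled A B C D)).trace) := by
  have h := tendsto_one_add_pow_exp (coupled A B C D) (A ⊗ₖ B)
  simp only [sum_stepFactor]
  have hc : Continuous fun Y : Matrix (n × n) (n × n) ℝ => ((Q ⊗ₖ Q) * Y).trace := by fun_prop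
  exact (hc.tendsto _).comp h

theorem trace_exp_coupled_nonneg [Nonempty n] (Q A : Matrix n n ℝ) (C : I → Matrix n n ℝ) :
    0 ≤ ((Q ⊗ₖ Q) * NormedSpace.exp (coupled A A C C)).trace :=
  ge_of_tendsto' (tendsto_trace_stepFactor Q A A C C) fun k =>
    trace_sum_kronecker_pow_nonneg _ _ k

/-- Reflection positivity in the form of a Cauchy–Schwarz inequality. -/
theorem trace_exp_coupled_sq_le [Nonempty n] (Q A B : Matrix n n ℝ) (C D : I → Matrix n n ℝ) :
    ((Q ⊗ₖ Q) * NormedSpace.exp (coupled A B C D)).trace ^ 2 ≤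
      ((Q ⊗ₖ Q) * NormedSpace.exp (coupled A A C C)).trace *
        ((Q ⊗ₖ Q) * NormedSpace.exp (coupled B B D D)).trace :=
  le_of_tendsto_of_tendsto' ((tendsto_trace_stepFactor Q A B C D).pow 2)
    ((tendsto_trace_stepFactor Q A A C C).mul (tendsto_trace_stepFactor Q B B D D))
    fun k => trace_sum_kronecker_pow_sq_le _ _ _ k

end ReflectionPositivity

end PiFlux

namespace PiFlux

/-! ### Representations of the anticommutation relations -/

section CAR

variable {V A A' : Type*} [Ring A] [Ring A']

/-- The canonical anticommutation relations for annihilators `c` and creators `d`. -/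
structure IsCAR [DecidableEq V] (c d : V → A) : Prop where
  cc : ∀ x y, c x * c y + c y * c x = 0
  dd : ∀ x y, d x * d y + d y * d x = 0
  dc : ∀ x y, d x * c y + c y * d x = if x = y then 1 else 0

/-- An involution that anticommutes with all annihilators and creators. -/
structure IsGrading (c d : V → A) (p : A) : Prop where
  mul_self : p * p = 1
  c : ∀ x, p * c x = -(c x * p)
  d : ∀ x, p * d x = -(d x * p)

/-- `(-1)^N` as a polynomial in the creators and annihilators. -/
noncomputable def parityWord [Fintype V] (c d : V → A) : A :=
  ((Finset.univ : Finset V).toList.map fun x => 1 - 2 * (d x * c x)).prod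

/-- The operator inserted in the trace: `(-1)^N` or `1`. -/
noncomputable def insertion [Fintype V] (b : Bool) (c d : V → A) : A :=
  if b then parityWord c d else 1

theorem map_insertion [Fintype V] (f : A →+* A') (b : Bool) (c d : V → A) :
    f (insertion b c d) = insertion b (fun x => f (c x)) (fun x => f (d x)) := by
  unfold insertion parityWord
  split_ifs
  · rw [map_list_prod, List.map_map]
    congr 1
    refine List.map_congr_left fun x _ => ?_
    simp [map_ofNat f 2]
  · simp

variable [Algebra ℝ A] [Algebra ℝ A']

/-- This is why `(-1)^N` is defined as a word in the generators: it lies in the algebra on which the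
relations determine the normalized trace. -/
theorem insertion_mem [Fintype V] {S : Subalgebra ℝ A} {c d : V → A} (hc : ∀ x, c x ∈ S)
    (hd : ∀ x, d x ∈ S) (b : Bool) : insertion b c d ∈ S := by
  unfold insertion parityWord
  split_ifs
  · refine Subalgebra.list_prod_mem _ fun y hy => ?_
    obtain ⟨x, -, rfl⟩ := List.mem_map.1 hy
    exact sub_mem (one_mem _) (mul_mem (ofNat_mem S 2) (mul_mem (hd x) (hc x)))
  · exact one_mem _

end CAR

/-- The edges of the torus; `(x, μ)` is the edge from `x` to `x + e μ`. -/
abbrev Edge (L : ℕ) : Type := Torus L × Fin 2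

/-- The endpoint `x + e μ` of the edge `(x, μ)`. -/
abbrev Edge.tgt {L : ℕ} (i : Edge L) : Torus L := i.1 + e i.2

section Hop

variable {L : ℕ} [NeZero L] {A A' : Type*} [Ring A] [Ring A'] [Algebra ℝ A] [Algebra ℝ A']

/-- The hopping operator with amplitudes `w`. -/
def hop (c d : Torus L → A) (w : Edge L → ℝ) : A :=
  ∑ i : Edge L, w i • (d i.1 * c i.tgt + d i.tgt * c i.1)

theorem map_hop (f : A →ₐ[ℝ] A') (c d : Torus L → A) (w : Edge L → ℝ) :
    f (hop c d w) = hop (fun x => f (c x)) (fun x => f (d x)) w := by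
  simp [hop]

theorem hop_mem {S : Subalgebra ℝ A} {c d : Torus L → A} (hc : ∀ x, c x ∈ S)
    (hd : ∀ x, d x ∈ S) (w : Edge L → ℝ) : hop c d w ∈ S :=
  sum_mem fun _ _ => S.smul_mem (add_mem (mul_mem (hd _) (hc _)) (mul_mem (hd _) (hc _))) _

variable {n m : Type*} [Fintype n] [DecidableEq n] [Fintype m] [DecidableEq m]

/-- The (normalized) partition functions depend only on the anticommutation relations. -/
theorem IsCAR.trace_exp_hop_eq {c d : Torus L → Matrix n n ℝ} {c' d' : Torus L → Matrix m m ℝ}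
    (h : IsCAR c d) (h' : IsCAR c' d') {p : Matrix n n ℝ} {p' : Matrix m m ℝ}
    (hp : IsGrading c d p) (hp' : IsGrading c' d' p') (b : Bool) (w : Edge L → ℝ) :
    (Fintype.card m : ℝ) * (insertion b c d * NormedSpace.exp (hop c d w)).trace =
      Fintype.card n * (insertion b c' d' * NormedSpace.exp (hop c' d' w)).trace := by
  -- The pairs represent the same relations in the product algebra. The functional `τ` below is the
  -- difference of the two traces, weighted so as to vanish at `1`.
  let C : Torus L → Matrix n n ℝ × Matrix m m ℝ := fun x => (c x, c' x)
  let D : Torus L → Matrix n n ℝ × Matrix m m ℝ := fun x => (d x, d' x)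
  let B : Torus L ⊕ Torus L → Torus L ⊕ Torus L → ℝ
    | .inl _, .inl _ => 0
    | .inr _, .inr _ => 0
    | .inl x, .inr y => if x = y then 1 else 0
    | .inr x, .inl y => if x = y then 1 else 0
  have hB : CliffordRel B (Sum.elim C D) := by
    rintro (x | x) (y | y)
    · ext1 <;> simp [B, C, h.cc, h'.cc]
    · have h1 := h.dc y x
      have h2 := h'.dc y x
      rw [add_comm] at h1 h2
      simp only [eq_comm (a := y)] at h1 h2
      by_cases hxy : x = y <;> ext1 <;> simp_all [B, C, D]
    · have h1 := h.dc x y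
      have h2 := h'.dc x y
      by_cases hxy : x = y <;> ext1 <;> simp_all [B, C, D]
    · ext1 <;> simp [B, D, h.dd, h'.dd]
  let τ : Matrix n n ℝ × Matrix m m ℝ →ₗ[ℝ] ℝ :=
    (Fintype.card m : ℝ) • (Matrix.traceLinearMap n ℝ ℝ ∘ₗ LinearMap.fst ℝ _ _) -
      (Fintype.card n : ℝ) • (Matrix.traceLinearMap m ℝ ℝ ∘ₗ LinearMap.snd ℝ _ _)
  have hτ : ∀ X, τ X = Fintype.card m * X.1.trace - Fintype.card n * X.2.trace := by
    intro X; simp [τ]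
  have hC : ∀ x, C x ∈ Algebra.adjoin ℝ (Set.range (Sum.elim C D)) := fun x =>
    Algebra.subset_adjoin ⟨.inl x, rfl⟩
  have hD : ∀ x, D x ∈ Algebra.adjoin ℝ (Set.range (Sum.elim C D)) := fun x =>
    Algebra.subset_adjoin ⟨.inr x, rfl⟩
  have key : ∀ k : ℕ, (Fintype.card m : ℝ) * (insertion b c d * hop c d w ^ k).trace =
      Fintype.card n * (insertion b c' d' * hop c' d' w ^ k).trace := by
    intro k
    have h0 := trace_adjoin_eq_zero hB τ
      (fun X Y => by rw [hτ, hτ]; simp [Matrix.trace_mul_comm X.1, Matrix.trace_mul_comm X.2])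
      (by rw [hτ]; simp [mul_comm]) (P := (p, p'))
      (by ext1 <;> simp [hp.mul_self, hp'.mul_self])
      (by rintro (x | x) <;> ext1 <;> simp [C, D, hp.c, hp'.c, hp.d, hp'.d])
      (mul_mem (insertion_mem hC hD b) (pow_mem (hop_mem hC hD w) k))
    have f1 : (insertion b C D * hop C D w ^ k).1 = insertion b c d * hop c d w ^ k := by
      have e1 := map_insertion (RingHom.fst (Matrix n n ℝ) (Matrix m m ℝ)) b C D
      have e2 := map_hop (AlgHom.fst ℝ (Matrix n n ℝ) (Matrix m m ℝ)) C D w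
      simp only [RingHom.coe_fst, AlgHom.fst_apply] at e1 e2
      rw [Prod.fst_mul, Prod.pow_fst, e1, e2]
    have f2 : (insertion b C D * hop C D w ^ k).2 = insertion b c' d' * hop c' d' w ^ k := by
      have e1 := map_insertion (RingHom.snd (Matrix n n ℝ) (Matrix m m ℝ)) b C D
      have e2 := map_hop (AlgHom.snd ℝ (Matrix n n ℝ) (Matrix m m ℝ)) C D w
      simp only [RingHom.coe_snd, AlgHom.snd_apply] at e1 e2
      rw [Prod.snd_mul, Prod.pow_snd, e1, e2]
    rw [hτ, f1, f2] at h0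
    linarith
  have s1 := (hasSum_trace_mul_exp (insertion b c d) (hop c d w)).mul_left (Fintype.card m : ℝ)
  have s2 := (hasSum_trace_mul_exp (insertion b c' d') (hop c' d' w)).mul_left
    (Fintype.card n : ℝ)
  refine s1.unique (s2.congr_fun fun k => ?_)
  rw [mul_left_comm, key k, mul_left_comm]

end Hop

/-! ### The Fock representation over the reals, and gauge invariance -/

section RealFock

variable {L : ℕ}

/-- The sites' annihilators, as real matrices. -/
noncomputable def ann (x : Torus L) : Matrix (Finset (Torus L)) (Finset (Torus L)) ℝ :=
  (annihilate x).map Complex.re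

/-- The sites' creators, as real matrices. -/
noncomputable def cre (x : Torus L) : Matrix (Finset (Torus L)) (Finset (Torus L)) ℝ :=
  (ann x)ᵀ

/-- The parity operator, as a real matrix. -/
noncomputable def par (L : ℕ) : Matrix (Finset (Torus L)) (Finset (Torus L)) ℝ :=
  Matrix.diagonal fun S => (-1) ^ S.card

variable [NeZero L]

/-- The inclusion of the real operators. -/
noncomputable abbrev toComplex (L : ℕ) [NeZero L] :
    Matrix (Finset (Torus L)) (Finset (Torus L)) ℝ →+* FockOp L :=
  Complex.ofRealHom.mapMatrix

theorem toComplex_injective : Function.Injective (toComplex L) :=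
  Matrix.map_injective Complex.ofReal_injective

theorem toComplex_ann (x : Torus L) : toComplex L (ann x) = annihilate x := by
  ext S T
  simp only [ann, RingHom.mapMatrix_apply, Matrix.map_apply, annihilate, Matrix.of_apply,
    Complex.ofRealHom_eq_coe]
  rw [← Complex.conj_eq_iff_re]
  split_ifs <;> simp [jwSign]

theorem toComplex_cre (x : Torus L) : toComplex L (cre x) = create x := by
  rw [create, ← toComplex_ann]
  ext S T
  simp [cre]

theorem toComplex_par : toComplex L (par L) = parity L := by
  ext S T
  by_cases h : S = T <;> simp [par, parity, h]

theorem isCAR_ann : IsCAR (ann (L := L)) cre where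
  cc x y := toComplex_injective <| by
    simp only [map_add, map_mul, toComplex_ann, annihilate_anticomm, map_zero]
  dd x y := toComplex_injective <| by
    simp only [map_add, map_mul, toComplex_cre, create_anticomm, map_zero]
  dc x y := toComplex_injective <| by
    simp only [map_add, map_mul, toComplex_ann, toComplex_cre, create_annihilate_anticomm]
    split_ifs <;> simp

theorem ann_apply {L : ℕ} (x : Torus L) (S T : Finset (Torus L)) :
    ann x S T = if x ∈ T ∧ S = T.erase x then (jwSign x T).re else 0 := by
  rw [ann, Matrix.map_apply, annihilate, Matrix.of_apply]
  split_ifs <;> simp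

theorem isGrading_par : IsGrading (ann (L := L)) cre (par L) := by
  have hc : ∀ x : Torus L, par L * ann x = -(ann x * par L) := by
    intro x
    ext S T
    rw [par, Matrix.diagonal_mul, Matrix.neg_apply, Matrix.mul_diagonal, ann_apply]
    split_ifs with h
    · obtain ⟨h1, rfl⟩ := h
      rw [← Finset.card_erase_add_one h1, pow_succ]
      ring
    · simp
  refine ⟨?_, hc, fun x => ?_⟩
  · rw [par, Matrix.diagonal_mul_diagonal, ← Matrix.diagonal_one]
    congr 1
    funext S
    rw [← mul_pow]
    simp
  · have h := congrArg Matrix.transpose (hc x)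
    rw [Matrix.transpose_neg, Matrix.transpose_mul, Matrix.transpose_mul, par,
      Matrix.diagonal_transpose, ← par] at h
    rw [cre, ← neg_eq_iff_eq_neg, h]

/-- The occupation number of `x`. -/
theorem cre_mul_ann (x : Torus L) :
    cre x * ann x = Matrix.diagonal fun S => if x ∈ S then (1 : ℝ) else 0 := by
  apply toComplex_injective
  rw [map_mul, toComplex_cre, toComplex_ann]
  ext S T
  rw [create_mul_apply, ← mul_one (annihilate x), annihilate_mul_apply]
  simp only [RingHom.mapMatrix_apply, Matrix.map_apply, Matrix.diagonal_apply]
  split_ifs with hx hx' hS hS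
  · simp at hx'
  · simp at hx'
  · have h1 : jwSign x S = jwSign x (S.erase x) := by
      conv_lhs => rw [← Finset.insert_erase hx]
      rw [jwSign_insert (by simp), if_neg (lt_irrefl _)]
    rw [h1, ← mul_assoc, jwSign_mul_self, one_mul, Finset.insert_erase hx, hS]
    simp
  · rw [Finset.insert_erase hx, Matrix.one_apply_ne hS]
    simp
  · simp
  · simp

theorem prod_map_diagonal {V n : Type*} [Fintype n] [DecidableEq n] (f : V → n → ℝ)
    (l : List V) :
    (l.map fun x => Matrix.diagonal (f x)).prod = Matrix.diagonal fun i => (l.map fun x => f x i).prod := by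
  induction l with
  | nil => simp
  | cons x l ih => simp [ih]

theorem insertion_true_ann : insertion true (ann (L := L)) cre = par L := by
  rw [insertion, if_pos rfl, parityWord]
  have : ∀ x : Torus L, 1 - 2 * (cre x * ann x) =
      Matrix.diagonal fun S => if x ∈ S then (-1 : ℝ) else 1 := by
    intro x
    rw [cre_mul_ann, ← Matrix.diagonal_one, ← Matrix.diagonal_ofNat, Matrix.diagonal_mul_diagonal,
      Matrix.diagonal_sub]
    congr 1
    funext S
    split_ifs <;> norm_num
  simp only [this]
  rw [prod_map_diagonal, par]
  congr 1
  funext S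
  rw [Finset.prod_map_toList]
  simp

/-- The partition functions for general hopping amplitudes. -/
noncomputable def partition (b : Bool) (w : Edge L → ℝ) : ℝ :=
  (insertion b ann cre * NormedSpace.exp (hop ann cre w)).trace

/-- The hopping amplitudes of a gauge field. -/
def amplitude (s : ℝ) (σ : GaugeField L) : Edge L → ℝ := fun i => s * ((σ i.1 i.2 : ℤ) : ℝ)

theorem toComplex_hop (t β : ℝ) (σ : GaugeField L) :
    toComplex L (hop ann cre (amplitude (β * t) σ)) = (-β : ℂ) • hamiltonian t σ := by
  have hs : ∀ (r : ℝ) (M : Matrix (Finset (Torus L)) (Finset (Torus L)) ℝ),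
      toComplex L (r • M) = (r : ℂ) • toComplex L M := by
    intro r M
    ext S T
    simp
  rw [hop, hamiltonian, smul_smul, map_sum, Fintype.sum_prod_type, Finset.smul_sum]
  refine Finset.sum_congr rfl fun x _ => ?_
  rw [Finset.smul_sum]
  refine Finset.sum_congr rfl fun μ _ => ?_
  rw [hs, map_add, map_mul, map_mul, toComplex_cre, toComplex_ann, toComplex_cre, toComplex_ann,
    Matrix.conjTranspose_smul, Matrix.conjTranspose_mul, create, create,
    Matrix.conjTranspose_conjTranspose, amplitude]
  rw [show star (((σ x μ : ℤ)) : ℂ) = ((σ x μ : ℤ) : ℂ) by simp, ← smul_add, smul_smul]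
  congr 1
  push_cast
  ring

theorem toComplex_exp (M : Matrix (Finset (Torus L)) (Finset (Torus L)) ℝ) :
    toComplex L (NormedSpace.exp M) = NormedSpace.exp (toComplex L M) := by
  have hc : Continuous (toComplex L) :=
    Continuous.matrix_map continuous_id Complex.continuous_ofReal
  open scoped Matrix.Norms.Operator in
  exact NormedSpace.map_exp (toComplex L) hc M

theorem trace_toComplex (M : Matrix (Finset (Torus L)) (Finset (Torus L)) ℝ) :
    (toComplex L M).trace = (M.trace : ℂ) := by
  simp [Matrix.trace]

theorem evenZ_eq (t β : ℝ) (σ : GaugeField L) :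
    evenZ t β σ = partition false (amplitude (β * t) σ) := by
  rw [evenZ, evenTrace, ← toComplex_hop, ← toComplex_exp, trace_toComplex, Complex.ofReal_re,
    partition, insertion, if_neg (by simp), one_mul]

theorem oddZ_eq (t β : ℝ) (σ : GaugeField L) :
    oddZ t β σ = partition true (amplitude (β * t) σ) := by
  rw [oddZ, oddTrace, ← toComplex_hop, ← toComplex_exp, ← toComplex_par, ← map_mul,
    trace_toComplex, Complex.ofReal_re, partition, insertion_true_ann]

/-- Invariance of the partition functions under gauge transformations. -/
theorem partition_gauge (b : Bool) (w : Edge L → ℝ) (g : Torus L → ℝ) (hg : ∀ x, g x * g x = 1) :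
    partition b (fun i => g i.1 * g i.tgt * w i) = partition b w := by
  have h : IsCAR (fun x : Torus L => g x • ann x) (fun x => g x • cre x) := by
    constructor
    · intro x y
      have := isCAR_ann.cc x y
      rw [smul_mul_smul_comm, smul_mul_smul_comm, mul_comm (g y), ← smul_add, this, smul_zero]
    · intro x y
      have := isCAR_ann.dd x y
      rw [smul_mul_smul_comm, smul_mul_smul_comm, mul_comm (g y), ← smul_add, this, smul_zero]
    · intro x y
      have := isCAR_ann.dc x y
      rw [smul_mul_smul_comm, smul_mul_smul_comm, mul_comm (g y), ← smul_add, this]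
      split_ifs with hxy
      · rw [hxy, hg, one_smul]
      · simp
  have hp : IsGrading (fun x : Torus L => g x • ann x) (fun x => g x • cre x) (par L) :=
    ⟨isGrading_par.mul_self, fun x => by simp [isGrading_par.c], fun x => by
      simp [isGrading_par.d]⟩
  -- The rescaled operators satisfy the same relations, so a gauge transformation is a change of
  -- representation.
  have key := isCAR_ann.trace_exp_hop_eq h isGrading_par hp b w
  have h1 : insertion b (fun x : Torus L => g x • ann x) (fun x => g x • cre x) =
      insertion b ann cre := by
    unfold insertion parityWord
    simp only [smul_mul_smul_comm, hg, one_smul]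
  have h2 : hop (fun x : Torus L => g x • ann x) (fun x => g x • cre x) w =
      hop ann cre fun i => g i.1 * g i.tgt * w i := by
    unfold hop
    refine Finset.sum_congr rfl fun i _ => ?_
    rw [smul_mul_smul_comm, smul_mul_smul_comm, mul_comm (g i.tgt), ← smul_add, smul_smul,
      mul_comm (w i)]
  rw [h1, h2] at key
  have h0 : (Fintype.card (Finset (Torus L)) : ℝ) ≠ 0 := by simp
  exact (mul_left_cancel₀ h0 key).symm

end RealFock

end PiFlux

/-! ### Reflections and the representation on the tensor square -/

namespace PiFlux

open scoped Kronecker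

/-- A reflection of the torus through a plane that cuts edges. -/
structure Reflection (L : ℕ) where
  /-- the sites on the left of the plane -/
  left : Torus L → Bool
  /-- the reflection of sites -/
  site : Torus L → Torus L
  /-- the reflection of edges -/
  edge : Edge L → Edge L
  site_site : ∀ x, site (site x) = x
  left_site : ∀ x, left (site x) = !left x
  edge_edge : ∀ i, edge (edge i) = i
  edge_ends : ∀ i : Edge L, ((edge i).1 = site i.1 ∧ (edge i).tgt = site i.tgt) ∨
    ((edge i).1 = site i.tgt ∧ (edge i).tgt = site i.1)
  tgt_of_cross : ∀ i : Edge L, left i.1 ≠ left i.tgt → i.tgt = site i.1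
  tgt_ne : ∀ i : Edge L, i.tgt ≠ i.1

section Conj

variable {L : ℕ} [NeZero L]

theorem par_ann_par (x : Torus L) : par L * ann x * par L = -ann x := by
  rw [isGrading_par.c, neg_mul, mul_assoc, isGrading_par.mul_self, mul_one]

theorem par_cre_par (x : Torus L) : par L * cre x * par L = -cre x := by
  rw [isGrading_par.d, neg_mul, mul_assoc, isGrading_par.mul_self, mul_one]

theorem ann_mul_cre (x : Torus L) : ann x * cre x = 1 - cre x * ann x := by
  have h := isCAR_ann.dc x x
  rw [if_pos rfl] at h
  rw [← h]
  abel

theorem ann_mul_cre_of_ne {x y : Torus L} (h : x ≠ y) : ann x * cre y = -(cre y * ann x) := by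
  have := isCAR_ann.dc y x
  rw [if_neg h.symm] at this
  exact eq_neg_of_add_eq_zero_right this

theorem sum_kronecker {n I : Type*} [Fintype I] (f : I → Matrix n n ℝ) (B : Matrix n n ℝ) :
    (∑ i, f i) ⊗ₖ B = ∑ i, f i ⊗ₖ B := by
  ext
  simp [Matrix.sum_apply, Finset.sum_mul]

theorem kronecker_sum {n I : Type*} [Fintype I] (A : Matrix n n ℝ) (f : I → Matrix n n ℝ) :
    A ⊗ₖ (∑ i, f i) = ∑ i, A ⊗ₖ f i := by
  ext
  simp [Matrix.sum_apply, Finset.mul_sum]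

theorem neg_kronecker {n : Type*} (A B : Matrix n n ℝ) : (-A) ⊗ₖ B = -(A ⊗ₖ B) := by
  ext
  simp

theorem kronecker_neg {n : Type*} (A B : Matrix n n ℝ) : A ⊗ₖ (-B) = -(A ⊗ₖ B) := by
  ext
  simp

end Conj

namespace Reflection

variable {L : ℕ} [NeZero L] (R : Reflection L)

/-- The operators on the tensor square of the Fock space. -/
abbrev DoubleOp (L : ℕ) : Type :=
  Matrix (Finset (Torus L) × Finset (Torus L)) (Finset (Torus L) × Finset (Torus L)) ℝ

/-- The annihilators on the tensor square: the sites on the left act on the first factor, and those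
on the right on the second, with a particle-hole transformation. -/
noncomputable def ann₂ (x : Torus L) : DoubleOp L :=
  if R.left x then (par L * ann x) ⊗ₖ 1 else par L ⊗ₖ cre (R.site x)

/-- The creators on the tensor square. -/
noncomputable def cre₂ (x : Torus L) : DoubleOp L :=
  if R.left x then (cre x * par L) ⊗ₖ 1 else par L ⊗ₖ ann (R.site x)

theorem site_inj {L : ℕ} (R : Reflection L) {x y : Torus L} : R.site x = R.site y ↔ x = y :=
  ⟨fun h => by rw [← R.site_site x, h, R.site_site], fun h => by rw [h]⟩

/-- The factor `par L` on the first tensor factor makes left and right operators anticommute.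
Putting it on the left operators as well lets it cancel in every hopping term across the plane, as
positivity requires. Exchanging `ann` and `cre` on the right preserves the relations. -/
theorem isCAR : IsCAR R.ann₂ R.cre₂ where
  cc x y := by
    have h1 : ∀ x y : Torus L, par L * ann x * (par L * ann y) = -(ann x * ann y) := by
      intro x y; rw [← mul_assoc, par_ann_par, neg_mul]
    have h2 : ∀ x : Torus L, par L * (par L * ann x) = ann x := by
      intro x; rw [← mul_assoc, isGrading_par.mul_self, one_mul]
    unfold ann₂
    split_ifs <;> simp only [← Matrix.mul_kronecker_mul, mul_one, one_mul, h1, h2, par_ann_par,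
      isGrading_par.mul_self]
    · rw [← Matrix.add_kronecker, ← neg_add, isCAR_ann.cc, neg_zero, Matrix.zero_kronecker]
    · rw [← Matrix.add_kronecker, neg_add_cancel, Matrix.zero_kronecker]
    · rw [← Matrix.add_kronecker, add_neg_cancel, Matrix.zero_kronecker]
    · rw [← Matrix.kronecker_add, isCAR_ann.dd, Matrix.kronecker_zero]
  dd x y := by
    have h1 : ∀ x y : Torus L, cre x * par L * (cre y * par L) = -(cre x * cre y) := by
      intro x y; rw [mul_assoc, ← mul_assoc (par L), par_cre_par, mul_neg]
    have h2 : ∀ x : Torus L, cre x * par L * par L = cre x := by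
      intro x; rw [mul_assoc, isGrading_par.mul_self, mul_one]
    have h3 : ∀ x : Torus L, par L * (cre x * par L) = -cre x := by
      intro x; rw [← mul_assoc, par_cre_par]
    unfold cre₂
    split_ifs <;> simp only [← Matrix.mul_kronecker_mul, mul_one, one_mul, h1, h2, h3,
      isGrading_par.mul_self]
    · rw [← Matrix.add_kronecker, ← neg_add, isCAR_ann.dd, neg_zero, Matrix.zero_kronecker]
    · rw [← Matrix.add_kronecker, add_neg_cancel, Matrix.zero_kronecker]
    · rw [← Matrix.add_kronecker, neg_add_cancel, Matrix.zero_kronecker]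
    · rw [← Matrix.kronecker_add, isCAR_ann.cc, Matrix.kronecker_zero]
  dc x y := by
    have h1 : ∀ x y : Torus L, cre x * par L * (par L * ann y) = cre x * ann y := by
      intro x y
      rw [mul_assoc, ← mul_assoc (par L), isGrading_par.mul_self, one_mul]
    have h2 : ∀ x y : Torus L, par L * ann y * (cre x * par L) = ann y * cre x := by
      intro x y
      rw [isGrading_par.c, neg_mul, mul_assoc, ← mul_assoc (par L), par_cre_par, mul_neg, neg_neg]
    have h3 : ∀ x : Torus L, cre x * par L * par L = cre x := by
      intro x; rw [mul_assoc, isGrading_par.mul_self, mul_one]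
    have h4 : ∀ x : Torus L, par L * (cre x * par L) = -cre x := by
      intro x; rw [← mul_assoc, par_cre_par]
    have h5 : ∀ x : Torus L, par L * (par L * ann x) = ann x := by
      intro x; rw [← mul_assoc, isGrading_par.mul_self, one_mul]
    unfold cre₂ ann₂
    have hne : R.left x ≠ R.left y → x ≠ y := fun h hxy => h (by rw [hxy])
    by_cases hx : R.left x = true <;> by_cases hy : R.left y = true <;>
      simp only [hx, hy, if_true, if_false, ← Matrix.mul_kronecker_mul, mul_one, one_mul, h1, h2,
        h3, h4, h5, par_ann_par, isGrading_par.mul_self, Bool.false_eq_true]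
    · rw [← Matrix.add_kronecker, isCAR_ann.dc]
      split_ifs
      · rw [Matrix.one_kronecker_one]
      · rw [Matrix.zero_kronecker]
    · rw [← Matrix.add_kronecker, add_neg_cancel, Matrix.zero_kronecker, if_neg (hne (by simp_all))]
    · rw [← Matrix.add_kronecker, add_neg_cancel, Matrix.zero_kronecker,
        if_neg (hne (by simp_all))]
    · rw [← Matrix.kronecker_add, add_comm, isCAR_ann.dc]
      simp only [R.site_inj, eq_comm (a := y)]
      split_ifs
      · rw [Matrix.one_kronecker_one]
      · rw [Matrix.kronecker_zero]

theorem isGrading : IsGrading R.ann₂ R.cre₂ (par L ⊗ₖ par L) where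
  mul_self := by
    rw [← Matrix.mul_kronecker_mul, isGrading_par.mul_self, Matrix.one_kronecker_one]
  c x := by
    unfold ann₂
    split_ifs
    · rw [← Matrix.mul_kronecker_mul, ← Matrix.mul_kronecker_mul, mul_one, one_mul,
        ← neg_kronecker, par_ann_par, neg_neg, ← mul_assoc, isGrading_par.mul_self, one_mul]
    · rw [← Matrix.mul_kronecker_mul, ← Matrix.mul_kronecker_mul, ← kronecker_neg,
        isGrading_par.d]
  d x := by
    unfold cre₂
    split_ifs
    · rw [← Matrix.mul_kronecker_mul, ← Matrix.mul_kronecker_mul, mul_one, one_mul,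
        ← neg_kronecker, ← mul_assoc, isGrading_par.d, neg_mul]
    · rw [← Matrix.mul_kronecker_mul, ← Matrix.mul_kronecker_mul, ← kronecker_neg,
        isGrading_par.c]

/-- The operator inserted in the trace over one factor. -/
noncomputable def halfInsertion (b : Bool) :
    Matrix (Finset (Torus L)) (Finset (Torus L)) ℝ :=
  if b then Matrix.diagonal fun S => ∏ x with R.left x, if x ∈ S then -1 else 1 else 1

/-- The particle-hole transformation multiplies `(-1)^N` by a sign for each site on the right; their
number `L² / 2` is even, so no sign remains. -/
theorem even_card_right (hL : Even L) :
    Even (Finset.univ.filter fun x : Torus L => ¬ R.left x = true).card := by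
  have h1 : (Finset.univ.filter fun x : Torus L => R.left x = true).card =
      (Finset.univ.filter fun x : Torus L => ¬ R.left x = true).card := by
    refine Finset.card_bij' (fun x _ => R.site x) (fun x _ => R.site x) ?_ ?_ ?_ ?_ <;>
      simp [R.left_site, R.site_site]
  have h2 := Finset.card_filter_add_card_filter_not (s := (Finset.univ : Finset (Torus L)))
    (fun x => R.left x = true)
  obtain ⟨k, hk⟩ := hL
  rw [h1, Finset.card_univ, Fintype.card_fun, ZMod.card, Fintype.card_fin] at h2
  refine ⟨k ^ 2, ?_⟩
  have h3 : L ^ 2 = 2 * (k ^ 2 + k ^ 2) := by rw [hk]; ring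
  omega

theorem insertion_eq (hL : Even L) (b : Bool) :
    insertion b R.ann₂ R.cre₂ = R.halfInsertion b ⊗ₖ R.halfInsertion b := by
  unfold insertion halfInsertion
  split_ifs
  swap
  · rw [Matrix.one_kronecker_one]
  have hf : ∀ x, 1 - 2 * (R.cre₂ x * R.ann₂ x) =
      Matrix.diagonal fun q : Finset (Torus L) × Finset (Torus L) =>
        if R.left x then (if x ∈ q.1 then (-1 : ℝ) else 1)
        else -1 * (if R.site x ∈ q.2 then -1 else 1) := by
    intro x
    have h1 : (1 : Matrix (Finset (Torus L)) (Finset (Torus L)) ℝ) =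
        Matrix.diagonal fun _ => 1 := Matrix.diagonal_one.symm
    have h1' : (1 : DoubleOp L) = Matrix.diagonal fun _ => 1 := Matrix.diagonal_one.symm
    have h2 : (2 : DoubleOp L) = (2 : ℝ) • 1 := by
      rw [← Algebra.algebraMap_eq_smul_one, map_ofNat]
    unfold cre₂ ann₂
    split_ifs with h
    · rw [← Matrix.mul_kronecker_mul, mul_assoc, ← mul_assoc (par L), isGrading_par.mul_self,
        one_mul, one_mul, cre_mul_ann, h2, h1, h1', Matrix.diagonal_kronecker_diagonal,
        smul_mul_assoc, Matrix.diagonal_mul_diagonal, ← Matrix.diagonal_smul,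
        Matrix.diagonal_sub]
      congr 1
      funext q
      simp only [Pi.smul_apply, smul_eq_mul]
      split_ifs <;> norm_num
    · rw [← Matrix.mul_kronecker_mul, isGrading_par.mul_self, ann_mul_cre, cre_mul_ann,
        h2, h1, h1', Matrix.diagonal_sub, Matrix.diagonal_kronecker_diagonal,
        smul_mul_assoc, Matrix.diagonal_mul_diagonal, ← Matrix.diagonal_smul,
        Matrix.diagonal_sub]
      congr 1
      funext q
      simp only [Pi.smul_apply, smul_eq_mul]
      split_ifs <;> norm_num
  rw [parityWord]
  simp only [hf]
  rw [prod_map_diagonal, Matrix.diagonal_kronecker_diagonal]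
  congr 1
  funext q
  rw [Finset.prod_map_toList, Finset.prod_ite]
  congr 1
  rw [Finset.prod_mul_distrib, Finset.prod_const, (R.even_card_right hL).neg_one_pow, one_mul]
  refine Finset.prod_bij' (fun x _ => R.site x) (fun x _ => R.site x) ?_ ?_ ?_ ?_ ?_ <;>
    simp [R.left_site, R.site_site]

end Reflection

end PiFlux

/-! ### The hopping operator across a plane and the reflection inequality -/

namespace PiFlux

open scoped Kronecker

namespace Reflection

variable {L : ℕ} (R : Reflection L)

/-- The operators on one side that couple to the other side across the plane. -/
noncomputable def crossing (w : Edge L → ℝ) :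
    Edge L × Bool → Matrix (Finset (Torus L)) (Finset (Torus L)) ℝ := fun q =>
  if R.left q.1.1 ≠ R.left q.1.tgt then
    w q.1 • (if q.2 then ann else cre) (if R.left q.1.1 then q.1.1 else q.1.tgt)
  else 0

/-- The amplitudes on the left, reflected to the right with the opposite sign. -/
def reflectLeft (w : Edge L → ℝ) (i : Edge L) : ℝ :=
  if R.left i.1 ∧ R.left i.tgt then w i
  else if ¬ R.left i.1 ∧ ¬ R.left i.tgt then -w (R.edge i) else |w i|

/-- The amplitudes on the right, reflected to the left with the opposite sign. -/
def reflectRight (w : Edge L → ℝ) (i : Edge L) : ℝ :=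
  if R.left i.1 ∧ R.left i.tgt then -w (R.edge i)
  else if ¬ R.left i.1 ∧ ¬ R.left i.tgt then w i else |w i|

theorem left_edge_iff (i : Edge L) :
    (R.left (R.edge i).1 ∧ R.left (R.edge i).tgt) ↔ ¬ R.left i.1 ∧ ¬ R.left i.tgt := by
  rcases R.edge_ends i with ⟨h1, h2⟩ | ⟨h1, h2⟩ <;> rw [h1, h2, R.left_site, R.left_site] <;>
    simp [and_comm]

theorem right_edge_iff (i : Edge L) :
    (¬ R.left (R.edge i).1 ∧ ¬ R.left (R.edge i).tgt) ↔ R.left i.1 ∧ R.left i.tgt := by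
  rcases R.edge_ends i with ⟨h1, h2⟩ | ⟨h1, h2⟩ <;> rw [h1, h2, R.left_site, R.left_site] <;>
    simp [and_comm]

/-- The reflection of edges as a permutation. -/
def edgeEquiv : Edge L ≃ Edge L := ⟨R.edge, R.edge, R.edge_edge, R.edge_edge⟩

theorem edgeEquiv_apply (i : Edge L) : R.edgeEquiv i = R.edge i := rfl

theorem crossing_congr {w w' : Edge L → ℝ}
    (h : ∀ i : Edge L, R.left i.1 ≠ R.left i.tgt → w i = w' i) : R.crossing w = R.crossing w' := by
  funext q
  unfold crossing
  by_cases hq : R.left q.1.1 ≠ R.left q.1.tgt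
  · rw [if_pos hq, if_pos hq, h _ hq]
  · rw [if_neg hq, if_neg hq]

theorem reflectLeft_of_cross (w : Edge L → ℝ) {i : Edge L} (h : R.left i.1 ≠ R.left i.tgt) :
    R.reflectLeft w i = |w i| := by
  rw [reflectLeft, if_neg, if_neg]
  · rintro ⟨h1, h2⟩; simp_all
  · rintro ⟨h1, h2⟩; simp_all

theorem reflectRight_of_cross (w : Edge L → ℝ) {i : Edge L} (h : R.left i.1 ≠ R.left i.tgt) :
    R.reflectRight w i = |w i| := by
  rw [reflectRight, if_neg, if_neg]
  · rintro ⟨h1, h2⟩; simp_all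
  · rintro ⟨h1, h2⟩; simp_all

variable [NeZero L]

/-- The hopping operator between two sites. -/
noncomputable def bond (x y : Torus L) : Matrix (Finset (Torus L)) (Finset (Torus L)) ℝ :=
  cre x * ann y + cre y * ann x

theorem bond_comm (x y : Torus L) : bond x y = bond y x := by
  rw [bond, bond, add_comm]

/-- The hopping on the left. -/
noncomputable def hopLeft (w : Edge L → ℝ) : Matrix (Finset (Torus L)) (Finset (Torus L)) ℝ :=
  ∑ i : Edge L, if R.left i.1 ∧ R.left i.tgt then w i • bond i.1 i.tgt else 0

/-- The hopping on the right, transported to the first factor. -/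
noncomputable def hopRight (w : Edge L → ℝ) : Matrix (Finset (Torus L)) (Finset (Torus L)) ℝ :=
  ∑ i : Edge L, if ¬ R.left i.1 ∧ ¬ R.left i.tgt then
    (-w i) • bond (R.site i.1) (R.site i.tgt) else 0

/-- A cut edge joins a site to its mirror image, so it becomes `cre x ⊗ cre x + ann x ⊗ ann x` with
`x` its left endpoint. Its amplitude is split as `√|w|` on one factor and `sign w · √|w|` on the
other. On the right, restoring the order of `ann` and `cre` gives the minus sign in `hopRight`. -/
theorem hop_eq_coupled (w : Edge L → ℝ) :
    hop R.ann₂ R.cre₂ w = coupled (R.hopLeft w) (R.hopRight w)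
      (R.crossing fun i => √|w i|) (R.crossing fun i => SignType.sign (w i) * √|w i|) := by
  rw [hop, coupled, hopLeft, hopRight, sum_kronecker, kronecker_sum,
    Fintype.sum_prod_type (α₁ := Edge L) (α₂ := Bool), ← Finset.sum_add_distrib, ← Finset.sum_add_distrib]
  refine Finset.sum_congr rfl fun i _ => ?_
  rw [Fintype.sum_bool]
  have h1 : ∀ x y : Torus L, cre x * par L * (par L * ann y) = cre x * ann y := by
    intro x y
    rw [mul_assoc, ← mul_assoc (par L), isGrading_par.mul_self, one_mul]
  have h3 : ∀ x : Torus L, cre x * par L * par L = cre x := by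
    intro x; rw [mul_assoc, isGrading_par.mul_self, mul_one]
  have h5 : ∀ x : Torus L, par L * (par L * ann x) = ann x := by
    intro x; rw [← mul_assoc, isGrading_par.mul_self, one_mul]
  have hw : SignType.sign (w i) * √|w i| * √|w i| = w i := by
    rw [mul_assoc, Real.mul_self_sqrt (abs_nonneg _), sign_mul_abs]
  have hs := R.tgt_of_cross i
  by_cases hx : R.left i.1 = true <;> by_cases hy : R.left i.tgt = true
  · simp only [cre₂, ann₂, crossing, hx, hy, ← Matrix.mul_kronecker_mul, if_true, mul_one, h1,
      ne_eq, not_true, if_false, add_zero, and_self, Matrix.kronecker_zero,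
      bond, Matrix.smul_kronecker, Matrix.add_kronecker]
  · have hy' : R.left i.tgt = false := by simpa using hy
    have hs' := hs (by simp [hx, hy'])
    simp only [cre₂, ann₂, crossing, hx, hy', ← Matrix.mul_kronecker_mul, if_true, mul_one, one_mul,
      ne_eq, if_false, Matrix.zero_kronecker, add_zero, zero_add, Matrix.kronecker_zero,
      Matrix.smul_kronecker, Matrix.kronecker_smul, smul_smul, Bool.false_eq_true, and_false,
      not_true, not_false_eq_true, false_and, h3, h5, Bool.true_eq_false]
    rw [hw, show R.site i.tgt = i.1 by rw [hs', R.site_site], ← smul_add, add_comm]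
  · have hx' : R.left i.1 = false := by simpa using hx
    have hs' := hs (by simp [hx', hy])
    simp only [cre₂, ann₂, crossing, hx', hy, ← Matrix.mul_kronecker_mul, if_true, mul_one, one_mul,
      ne_eq, if_false, Matrix.zero_kronecker, add_zero, zero_add, Matrix.kronecker_zero,
      Matrix.smul_kronecker, Matrix.kronecker_smul, smul_smul, Bool.false_eq_true, and_false,
      not_true, not_false_eq_true, false_and, h3, h5]
    rw [hw, ← hs', ← smul_add]
  · have hx' : R.left i.1 = false := by simpa using hx
    have hy' : R.left i.tgt = false := by simpa using hy
    have hne : R.site i.tgt ≠ R.site i.1 := fun h => R.tgt_ne i (R.site_inj.1 h)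
    simp only [cre₂, ann₂, crossing, hx', hy', ← Matrix.mul_kronecker_mul,
      ne_eq, not_true, if_false, Matrix.zero_kronecker, add_zero, zero_add, and_self,
      isGrading_par.mul_self, Bool.false_eq_true, not_false_eq_true, if_true]
    rw [ann_mul_cre_of_ne hne, ann_mul_cre_of_ne hne.symm, Matrix.kronecker_smul, kronecker_neg,
      kronecker_neg, bond, Matrix.kronecker_add, neg_smul, ← smul_neg, neg_add]
    congr 1
    rw [add_comm]

theorem bond_edge (i : Edge L) :
    bond (R.site (R.edge i).1) (R.site (R.edge i).tgt) = bond i.1 i.tgt := by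
  rcases R.edge_ends i with ⟨h1, h2⟩ | ⟨h1, h2⟩ <;> rw [h1, h2, R.site_site, R.site_site]
  rw [bond_comm]

theorem hopLeft_reflectLeft (w : Edge L → ℝ) : R.hopLeft (R.reflectLeft w) = R.hopLeft w := by
  refine Finset.sum_congr rfl fun i _ => ?_
  split_ifs with h
  · rw [reflectLeft, if_pos h]
  · rfl

theorem hopRight_reflectRight (w : Edge L → ℝ) :
    R.hopRight (R.reflectRight w) = R.hopRight w := by
  refine Finset.sum_congr rfl fun i _ => ?_
  split_ifs with h
  · rw [reflectRight, if_neg (fun h' => h.1 h'.1), if_pos h]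
  · rfl

/-- The minus sign in `reflectLeft` cancels the one from the particle-hole transformation. -/
theorem hopRight_reflectLeft (w : Edge L → ℝ) : R.hopRight (R.reflectLeft w) = R.hopLeft w := by
  refine Fintype.sum_equiv R.edgeEquiv _ _ fun i => ?_
  simp only [R.edgeEquiv_apply, R.left_edge_iff]
  split_ifs with h
  · rw [reflectLeft, if_neg (fun h' => h.1 h'.1), if_pos h, neg_neg]
    congr 1
    have := R.bond_edge (R.edge i)
    rw [R.edge_edge] at this
    exact this
  · rfl

theorem hopLeft_reflectRight (w : Edge L → ℝ) : R.hopLeft (R.reflectRight w) = R.hopRight w := by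
  refine Fintype.sum_equiv R.edgeEquiv _ _ fun i => ?_
  simp only [R.edgeEquiv_apply, R.right_edge_iff]
  split_ifs with h
  · rw [reflectRight, if_pos h, R.bond_edge]
  · rfl

theorem sign_abs_mul_sqrt (a : ℝ) : (SignType.sign |a| : ℝ) * √|a| = √|a| := by
  rcases eq_or_ne a 0 with rfl | h
  · simp
  · rw [sign_pos (abs_pos.2 h)]; simp

theorem hop_reflectLeft (w : Edge L → ℝ) :
    hop R.ann₂ R.cre₂ (R.reflectLeft w) = coupled (R.hopLeft w) (R.hopLeft w)
      (R.crossing fun i => √|w i|) (R.crossing fun i => √|w i|) := by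
  rw [hop_eq_coupled, hopLeft_reflectLeft, hopRight_reflectLeft]
  congr 1
  · refine R.crossing_congr fun i hi => ?_
    rw [R.reflectLeft_of_cross w hi, abs_abs]
  · refine R.crossing_congr fun i hi => ?_
    rw [R.reflectLeft_of_cross w hi, abs_abs, sign_abs_mul_sqrt]

theorem hop_reflectRight (w : Edge L → ℝ) :
    hop R.ann₂ R.cre₂ (R.reflectRight w) = coupled (R.hopRight w) (R.hopRight w)
      (R.crossing fun i => SignType.sign (w i) * √|w i|)
      (R.crossing fun i => SignType.sign (w i) * √|w i|) := by
  rw [hop_eq_coupled, hopLeft_reflectRight, hopRight_reflectRight, coupled, coupled]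
  congr 1
  refine Finset.sum_congr rfl fun q _ => ?_
  unfold crossing
  by_cases hq : R.left q.1.1 ≠ R.left q.1.tgt
  swap
  · simp only [if_neg hq]
  simp only [if_pos hq, R.reflectRight_of_cross w hq, abs_abs, sign_abs_mul_sqrt,
    Matrix.smul_kronecker, Matrix.kronecker_smul, smul_smul]
  congr 1
  rcases eq_or_ne (w q.1) 0 with h | h
  · simp [h]
  -- The sign occurs in both factors of the symmetrized coupling and squares to one, which leaves
  -- the amplitude `|w|`.
  · have : (SignType.sign (w q.1) : ℝ) * SignType.sign (w q.1) = 1 := by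
      rcases h.lt_or_gt with h | h
      · simp [sign_neg h]
      · simp [sign_pos h]
    linear_combination (-√|w q.1| * √|w q.1|) * this

/-- Each factor is a full Fock space although only half of the sites act on it; the idle sites
account for the multiplicity. -/
theorem card_mul_partition (hL : Even L) (b : Bool) (w : Edge L → ℝ) :
    Fintype.card (Finset (Torus L)) * partition b w =
      ((R.halfInsertion b ⊗ₖ R.halfInsertion b) *
        NormedSpace.exp (hop R.ann₂ R.cre₂ w)).trace := by
  have h := isCAR_ann.trace_exp_hop_eq R.isCAR isGrading_par R.isGrading b w
  rw [R.insertion_eq hL, Fintype.card_prod, Nat.cast_mul, mul_assoc] at h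
  have h0 : (Fintype.card (Finset (Torus L)) : ℝ) ≠ 0 := by simp
  exact mul_left_cancel₀ h0 h

theorem partition_reflectLeft_nonneg (hL : Even L) (b : Bool) (w : Edge L → ℝ) :
    0 ≤ partition b (R.reflectLeft w) := by
  have h0 : (0 : ℝ) < Fintype.card (Finset (Torus L)) := by simp
  have h := R.card_mul_partition hL b (R.reflectLeft w)
  rw [hop_reflectLeft] at h
  have h1 := trace_exp_coupled_nonneg (R.halfInsertion b) (R.hopLeft w)
    (R.crossing fun i => √|w i|)
  rw [← h] at h1
  exact nonneg_of_mul_nonneg_right h1 h0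

/-- Reflection positivity. -/
theorem partition_sq_le (hL : Even L) (b : Bool) (w : Edge L → ℝ) :
    partition b w ^ 2 ≤ partition b (R.reflectLeft w) * partition b (R.reflectRight w) := by
  have h0 : (0 : ℝ) < Fintype.card (Finset (Torus L)) := by simp
  have h := R.card_mul_partition hL b w
  have hl := R.card_mul_partition hL b (R.reflectLeft w)
  have hr := R.card_mul_partition hL b (R.reflectRight w)
  rw [hop_eq_coupled] at h
  rw [hop_reflectLeft] at hl
  rw [hop_reflectRight] at hr
  have key := trace_exp_coupled_sq_le (R.halfInsertion b) (R.hopLeft w) (R.hopRight w)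
    (R.crossing fun i => √|w i|) (R.crossing fun i => SignType.sign (w i) * √|w i|)
  rw [← h, ← hl, ← hr, mul_pow, mul_mul_mul_comm, ← pow_two] at key
  exact le_of_mul_le_mul_left key (by positivity)

end Reflection

end PiFlux

namespace PiFlux

/-! ### Coordinate reflections and planes of the torus -/

section ZModVal

variable {L : ℕ} [NeZero L]

theorem val_add_one_of_lt {y : ZMod L} (h : y.val + 1 < L) : (y + 1).val = y.val + 1 := by
  have : y + 1 = ((y.val + 1 : ℕ) : ZMod L) := by simp
  rw [this, ZMod.val_cast_of_lt h]

theorem add_one_eq_zero {y : ZMod L} (h : y.val + 1 = L) : y + 1 = 0 := by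
  have : y + 1 = ((y.val + 1 : ℕ) : ZMod L) := by simp
  rw [this, h, ZMod.natCast_self]

theorem val_neg_one_sub (y : ZMod L) : (-1 - y).val = L - 1 - y.val := by
  have h := ZMod.val_lt y
  have : -1 - y = ((L - 1 - y.val : ℕ) : ZMod L) := by
    rw [Nat.sub_sub, Nat.cast_sub (by omega)]
    simp
    ring
  rw [this, ZMod.val_cast_of_lt (by omega)]

/-- In both cases `2 * (y + 1)` vanishes modulo `L`. These are the last coordinates of the two
halves, where an edge leads to the mirror image. -/
theorem neg_one_sub_of_val {y : ZMod L} (hL : Even L) (h : y.val = L / 2 - 1 ∨ y.val = L - 1) :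
    -1 - y = y + 1 := by
  have hpos := Nat.pos_of_ne_zero (NeZero.ne L)
  obtain ⟨m, hm⟩ := hL
  have h2 : ((2 * (y.val + 1) : ℕ) : ZMod L) = 0 := by
    rw [ZMod.natCast_eq_zero_iff]
    rcases h with h | h <;> rw [h]
    · exact ⟨1, by omega⟩
    · exact ⟨2, by omega⟩
  push_cast at h2
  rw [ZMod.natCast_zmod_val] at h2
  linear_combination -h2

end ZModVal

section Plane

variable {L : ℕ}

theorem e_of_ne {μ ν : Fin 2} (h : μ ≠ ν) : (e ν : Torus L) μ = 0 := by
  simp [e, h]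

@[simp] theorem add_e_same (x : Torus L) (μ : Fin 2) : (x + e μ : Torus L) μ = x μ + 1 := by
  simp [e]

@[simp] theorem add_e_of_ne (x : Torus L) {μ ν : Fin 2} (h : μ ≠ ν) : (x + e ν : Torus L) μ = x μ := by
  simp [e, h]

/-- The reflection of sites through the plane perpendicular to the direction `μ` that separates
the coordinates `s - 1` and `s`. -/
def planeSite (μ : Fin 2) (s : ZMod L) (x : Torus L) : Torus L :=
  Function.update x μ (2 * s - 1 - x μ)

@[simp] theorem planeSite_same (μ : Fin 2) (s : ZMod L) (x : Torus L) :
    planeSite μ s x μ = 2 * s - 1 - x μ := by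
  simp [planeSite]

@[simp] theorem planeSite_of_ne {μ ν : Fin 2} (h : ν ≠ μ) (s : ZMod L) (x : Torus L) :
    planeSite μ s x ν = x ν := by
  simp [planeSite, h]

theorem planeSite_planeSite (μ : Fin 2) (s : ZMod L) (x : Torus L) :
    planeSite μ s (planeSite μ s x) = x := by
  funext κ
  by_cases h : κ = μ
  · subst h; simp
  · simp [h]

theorem planeSite_add_same (μ : Fin 2) (s : ZMod L) (x : Torus L) :
    planeSite μ s (x + e μ) + e μ = planeSite μ s x := by
  funext κ
  by_cases h : κ = μ
  · subst h
    rw [add_e_same, planeSite_same, planeSite_same, add_e_same]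
    ring
  · simp [h, e_of_ne h]

theorem planeSite_add_of_ne {μ ν : Fin 2} (hν : ν ≠ μ) (s : ZMod L) (x : Torus L) :
    planeSite μ s (x + e ν) = planeSite μ s x + e ν := by
  funext κ
  by_cases h : κ = μ
  · subst h
    rw [add_e_of_ne _ hν.symm, planeSite_same, planeSite_same, add_e_of_ne _ hν.symm]
  · by_cases h' : κ = ν
    · subst h'; simp [h]
    · simp [h]

variable [NeZero L]

theorem two_le (hL : Even L) : 2 ≤ L := by
  have := NeZero.ne L
  obtain ⟨m, hm⟩ := hL
  omega

/-- The reflection through the planes perpendicular to the direction `μ`, with the coordinates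
`s, …, s + L / 2 - 1` on the left. -/
def plane (hL : Even L) (μ : Fin 2) (s : ZMod L) : Reflection L where
  left x := decide ((x μ - s).val < L / 2)
  site := planeSite μ s
  edge i := if i.2 = μ then (planeSite μ s i.tgt, i.2) else (planeSite μ s i.1, i.2)
  site_site := planeSite_planeSite μ s
  left_site x := by
    have h := ZMod.val_lt (x μ - s)
    rw [planeSite_same, show 2 * s - 1 - x μ - s = -1 - (x μ - s) by ring, val_neg_one_sub]
    obtain ⟨m, hm⟩ := hL
    rw [← decide_not, decide_eq_decide]
    omega
  edge_edge i := by
    obtain ⟨x, ν⟩ := i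
    by_cases h : ν = μ
    · subst h
      simp only [if_true, Edge.tgt, planeSite_add_same, planeSite_planeSite]
    · simp only [h, if_false, planeSite_planeSite]
  edge_ends i := by
    obtain ⟨x, ν⟩ := i
    by_cases h : ν = μ
    · subst h
      right
      simp only [if_true, Edge.tgt, planeSite_add_same, and_self]
    · left
      simp only [h, if_false, Edge.tgt, planeSite_add_of_ne h, and_self]
  tgt_of_cross i hi := by
    obtain ⟨x, ν⟩ := i
    simp only [Edge.tgt] at hi ⊢
    by_cases h : ν = μ
    · subst h
      have hy : -1 - (x ν - s) = x ν - s + 1 := by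
        have hv := ZMod.val_lt (x ν - s)
        refine neg_one_sub_of_val hL ?_
        rw [ne_eq, decide_eq_decide, add_e_same, add_sub_right_comm] at hi
        by_cases hlt : (x ν - s).val + 1 < L
        · rw [val_add_one_of_lt hlt] at hi
          omega
        · omega
      funext κ
      by_cases hκ : κ = ν
      · subst hκ
        rw [add_e_same, planeSite_same]
        linear_combination -hy
      · simp [hκ, e_of_ne hκ]
    · rw [ne_eq, decide_eq_decide, add_e_of_ne _ (Ne.symm h)] at hi
      exact absurd Iff.rfl hi
  tgt_ne i h := by
    have h1 := congrFun h i.2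
    rw [Edge.tgt, add_e_same] at h1
    have : Fact (1 < L) := ⟨two_le hL⟩
    exact one_ne_zero (add_eq_left.1 h1)

end Plane

/-! ### Reflecting a maximizing gauge field -/

section ReflectGauge

variable {L : ℕ}

/-- The gauge field on the left, reflected to the right with the opposite sign. -/
def Reflection.gaugeLeft (R : Reflection L) (σ : GaugeField L) : GaugeField L := fun x μ =>
  if R.left x ∧ R.left (x + e μ) then σ x μ
  else if ¬ R.left x ∧ ¬ R.left (x + e μ) then -σ (R.edge (x, μ)).1 (R.edge (x, μ)).2 else 1

/-- The gauge field on the right, reflected to the left with the opposite sign. -/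
def Reflection.gaugeRight (R : Reflection L) (σ : GaugeField L) : GaugeField L := fun x μ =>
  if R.left x ∧ R.left (x + e μ) then -σ (R.edge (x, μ)).1 (R.edge (x, μ)).2
  else if ¬ R.left x ∧ ¬ R.left (x + e μ) then σ x μ else 1

theorem abs_amplitude {s : ℝ} (hs : 0 ≤ s) (σ : GaugeField L) (i : Edge L) :
    |amplitude s σ i| = s := by
  rw [amplitude, abs_mul, abs_of_nonneg hs]
  rcases Int.units_eq_one_or (σ i.1 i.2) with h | h <;> simp [h]

theorem reflectLeft_amplitude (R : Reflection L) {s : ℝ} (hs : 0 ≤ s) (σ : GaugeField L) :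
    R.reflectLeft (amplitude s σ) = amplitude s (R.gaugeLeft σ) := by
  funext i
  rw [Reflection.reflectLeft, abs_amplitude hs]
  unfold amplitude Reflection.gaugeLeft
  split_ifs <;> simp

theorem reflectRight_amplitude (R : Reflection L) {s : ℝ} (hs : 0 ≤ s) (σ : GaugeField L) :
    R.reflectRight (amplitude s σ) = amplitude s (R.gaugeRight σ) := by
  funext i
  rw [Reflection.reflectRight, abs_amplitude hs]
  unfold amplitude Reflection.gaugeRight
  split_ifs <;> simp

/-- The gauge field `σ` maximizes the partition function. -/
def IsMaximizer [NeZero L] (b : Bool) (s : ℝ) (σ : GaugeField L) : Prop :=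
  ∀ τ : GaugeField L, partition b (amplitude s τ) ≤ partition b (amplitude s σ)

variable [NeZero L]

theorem exists_isMaximizer (b : Bool) (s : ℝ) : ∃ σ : GaugeField L, IsMaximizer b s σ :=
  Finite.exists_max fun σ : GaugeField L => partition b (amplitude s σ)

/-- With `M` the maximum, `M² ≤ Z(left) Z(right) ≤ Z(left) M`, so `Z(left) < M` is impossible. The
bound `0 ≤ Z(left)` is used here, and it matters for the odd partition function, which is not
visibly nonnegative. -/
theorem IsMaximizer.gaugeLeft (hL : Even L) {b : Bool} {s : ℝ} (hs : 0 ≤ s) {σ : GaugeField L}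
    (h : IsMaximizer b s σ) (R : Reflection L) : IsMaximizer b s (R.gaugeLeft σ) := by
  have h1 := R.partition_sq_le hL b (amplitude s σ)
  have h0 := R.partition_reflectLeft_nonneg hL b (amplitude s σ)
  rw [reflectLeft_amplitude R hs, reflectRight_amplitude R hs] at h1
  rw [reflectLeft_amplitude R hs] at h0
  have h2 := h (R.gaugeLeft σ)
  have h3 := h (R.gaugeRight σ)
  intro τ
  refine (h τ).trans ?_
  by_contra! hlt
  nlinarith

end ReflectGauge

end PiFlux

namespace PiFlux

/-! ### Fluxes determine a gauge field up to gauge transformations -/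

section GaugeEquivalence

variable {L : ℕ}

theorem vec_add_e_zero (a b : ZMod L) : (![a, b] + e 0 : Torus L) = ![a + 1, b] := by
  funext i; fin_cases i <;> simp [e]

theorem vec_add_e_one (a b : ZMod L) : (![a, b] + e 1 : Torus L) = ![a, b + 1] := by
  funext i; fin_cases i <;> simp [e]

theorem single_zero_eq (a : ZMod L) : (Pi.single 0 a : Torus L) = ![a, 0] := by
  funext i; fin_cases i <;> simp

theorem single_one_eq (b : ZMod L) : (Pi.single 1 b : Torus L) = ![0, b] := by
  funext i; fin_cases i <;> simp

variable [NeZero L]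

/-- The products of `f` along the initial segments of `ZMod L`. -/
def potential (f : ZMod L → ℤˣ) (a : ZMod L) : ℤˣ := ∏ j ∈ Finset.range a.val, f j

theorem prod_range_eq_prod (f : ZMod L → ℤˣ) : ∏ j ∈ Finset.range L, f j = ∏ a, f a := by
  refine Finset.prod_bij' (fun j _ => (j : ZMod L)) (fun a _ => a.val) ?_ ?_ ?_ ?_ ?_
  · simp
  · intro a _; simpa using ZMod.val_lt a
  · intro j hj; exact ZMod.val_cast_of_lt (Finset.mem_range.1 hj)
  · simp
  · simp

theorem potential_add_one {f : ZMod L → ℤˣ} (hf : ∏ a, f a = 1) (a : ZMod L) :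
    potential f (a + 1) = potential f a * f a := by
  have h : potential f a * f a = ∏ j ∈ Finset.range (a.val + 1), f j := by
    rw [Finset.prod_range_succ, ZMod.natCast_zmod_val, potential]
  rw [h]
  have hlt := ZMod.val_lt a
  rcases Nat.lt_or_ge (a.val + 1) L with h1 | h1
  · rw [potential, val_add_one_of_lt h1]
  · have h2 : a.val + 1 = L := by omega
    rw [add_one_eq_zero h2, h2, prod_range_eq_prod, hf, potential, ZMod.val_zero,
      Finset.prod_range_zero]

theorem zmod_induction {p : ZMod L → Prop} (h0 : p 0) (h : ∀ a, p a → p (a + 1)) (a : ZMod L) :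
    p a := by
  rw [← ZMod.natCast_zmod_val a]
  induction a.val with
  | zero => simpa using h0
  | succ n ih => push_cast; exact h _ ih

/-- A gauge field without fluxes is a pure gauge. -/
theorem exists_gauge_of_flux_eq_one {η : GaugeField L} (hp : ∀ x, plaquetteFlux η x = 1)
    (hl : ∀ μ, loopFlux η μ = 1) : ∃ g : Torus L → ℤˣ, ∀ x μ, η x μ = g x * g (x + e μ) := by
  have hp' : ∀ a b : ZMod L,
      η ![a, b] 0 * η ![a + 1, b] 1 * η ![a, b + 1] 0 * η ![a, b] 1 = 1 := by
    intro a b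
    have := hp ![a, b]
    rwa [plaquetteFlux, vec_add_e_zero, vec_add_e_one] at this
  have hrow : ∏ a : ZMod L, η ![a, 0] 0 = 1 := by
    simpa only [loopFlux, single_zero_eq] using hl 0
  -- Multiplying the plaquettes of a vertical strip, the horizontal edges cancel in pairs, so
  -- neighbouring columns have the same loop flux.
  have hcol : ∀ a : ZMod L, ∏ b : ZMod L, η ![a, b] 1 = 1 := by
    refine zmod_induction (by simpa only [loopFlux, single_one_eq] using hl 1) fun a ha => ?_
    have h1 : ∏ b : ZMod L,
        (η ![a, b] 0 * η ![a + 1, b] 1 * η ![a, b + 1] 0 * η ![a, b] 1) = 1 :=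
      Finset.prod_eq_one fun b _ => hp' a b
    have h2 : ∏ b : ZMod L, η ![a, b + 1] 0 = ∏ b : ZMod L, η ![a, b] 0 :=
      Fintype.prod_equiv (Equiv.addRight 1) _ _ fun b => rfl
    rw [Finset.prod_mul_distrib, Finset.prod_mul_distrib, Finset.prod_mul_distrib, ha, h2, mul_one,
      mul_right_comm, Int.units_mul_self, one_mul] at h1
    exact h1
  -- The gauge function collects the signs along the horizontal axis and then up a column; trivial
  -- loop fluxes make both potentials consistent where the torus closes up.
  let H : ZMod L → ℤˣ := potential fun a => η ![a, 0] 0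
  let V : ZMod L → ZMod L → ℤˣ := fun a => potential fun b => η ![a, b] 1
  have hH : ∀ a, H (a + 1) = H a * η ![a, 0] 0 := potential_add_one hrow
  have hV : ∀ a b, V a (b + 1) = V a b * η ![a, b] 1 := fun a => potential_add_one (hcol a)
  have hV0 : ∀ a, V a 0 = 1 := fun a => by simp [V, potential]
  have e1 : ∀ A B : ℤˣ, A = B * (B * A) := by decide
  have ver : ∀ a b, η ![a, b] 1 = H a * V a b * (H a * V a (b + 1)) := by
    intro a b
    rw [hV, mul_mul_mul_comm, Int.units_mul_self, one_mul, ← mul_assoc, Int.units_mul_self,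
      one_mul]
  have hor : ∀ a b, η ![a, b] 0 = H a * V a b * (H (a + 1) * V (a + 1) b) := by
    intro a
    refine zmod_induction ?_ fun b hb => ?_
    · rw [hV0, hV0, mul_one, mul_one, hH]
      exact e1 _ _
    · have h1 := hp' a b
      rw [hb, ver, ver] at h1
      have e2 : ∀ p q r s u : ℤˣ, p * q * (q * s) * u * (p * r) = 1 → u = r * s := by decide
      exact e2 _ _ _ _ _ h1
  refine ⟨fun x => H (x 0) * V (x 0) (x 1), fun x μ => ?_⟩
  obtain ⟨a, b, rfl⟩ : ∃ a b, x = ![a, b] := ⟨x 0, x 1, by funext i; fin_cases i <;> rfl⟩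
  fin_cases μ
  · simp only [Fin.zero_eta, vec_add_e_zero]
    exact hor a b
  · simp only [Fin.mk_one, vec_add_e_one]
    exact ver a b

theorem partition_eq_of_fluxes_eq {σ τ : GaugeField L} (h : fluxes σ = fluxes τ) (b : Bool)
    (s : ℝ) : partition b (amplitude s σ) = partition b (amplitude s τ) := by
  have h1 : plaquetteFlux σ = plaquetteFlux τ := congrArg Prod.fst h
  have h2 : loopFlux σ = loopFlux τ := congrArg Prod.snd h
  obtain ⟨g, hg⟩ := exists_gauge_of_flux_eq_one (η := fun x μ => σ x μ * τ x μ)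
    (fun x => by
      have hx := congrFun h1 x
      have : ∀ a b c d a' b' c' d' : ℤˣ, a * a' * (b * b') * (c * c') * (d * d') =
          a * b * c * d * (a' * b' * c' * d') := by
        intros
        simp only [mul_comm, mul_left_comm]
      rw [plaquetteFlux, this, ← plaquetteFlux, ← plaquetteFlux, hx, Int.units_mul_self])
    (fun μ => by
      have hμ := congrFun h2 μ
      rw [loopFlux, Finset.prod_mul_distrib, ← loopFlux, ← loopFlux, hμ, Int.units_mul_self])
  rw [← partition_gauge b (amplitude s τ) (fun x => ((g x : ℤ) : ℝ))]
  · congr 1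
    funext i
    have hi : σ i.1 i.2 = g i.1 * g i.tgt * τ i.1 i.2 := by
      rw [← hg, mul_assoc, Int.units_mul_self, mul_one]
    rw [amplitude, amplitude, hi]
    push_cast
    ring
  · intro x
    rw [← Int.cast_mul, ← Units.val_mul, Int.units_mul_self]
    simp

end GaugeEquivalence

/-! ### Fluxes of a reflected gauge field -/

section Fluxes

variable {L : ℕ}

/-- The flux through the plaquette at `x`, with the edges in the directions `μ` and `ν`. -/
def plaquette (σ : GaugeField L) (μ ν : Fin 2) (x : Torus L) : ℤˣ :=
  σ x μ * σ (x + e μ) ν * σ (x + e ν) μ * σ x ν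

theorem plaquette_comm (σ : GaugeField L) (μ ν : Fin 2) (x : Torus L) :
    plaquette σ μ ν x = plaquette σ ν μ x := by
  unfold plaquette
  simp only [mul_comm, mul_left_comm]

variable [NeZero L] (hL : Even L) (μ : Fin 2) (s : ZMod L) (σ : GaugeField L)

theorem plane_left_iff (x : Torus L) : (plane hL μ s).left x = true ↔ (x μ - s).val < L / 2 := by
  simp [plane]

theorem plane_left_add_iff (x : Torus L) :
    (plane hL μ s).left (x + e μ) = true ↔ (x μ - s + 1).val < L / 2 := by
  rw [plane_left_iff, add_e_same, add_sub_right_comm]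

theorem plane_left_add_of_ne {ν : Fin 2} (h : ν ≠ μ) (x : Torus L) :
    (plane hL μ s).left (x + e ν) = (plane hL μ s).left x := by
  simp only [plane, add_e_of_ne _ h.symm]

theorem plane_edge_same (x : Torus L) :
    (plane hL μ s).edge (x, μ) = (planeSite μ s (x + e μ), μ) := by
  simp [plane]

theorem plane_edge_of_ne {ν : Fin 2} (h : ν ≠ μ) (x : Torus L) :
    (plane hL μ s).edge (x, ν) = (planeSite μ s x, ν) := by
  simp [plane, h]

theorem gaugeLeft_of_left {x : Torus L} {ν : Fin 2} (h1 : (x μ - s).val < L / 2)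
    (h2 : ν = μ → (x μ - s + 1).val < L / 2) : (plane hL μ s).gaugeLeft σ x ν = σ x ν := by
  rw [Reflection.gaugeLeft, if_pos]
  refine ⟨(plane_left_iff ..).2 h1, ?_⟩
  by_cases h : ν = μ
  · subst h
    exact (plane_left_add_iff ..).2 (h2 rfl)
  · rw [plane_left_add_of_ne _ _ _ h]
    exact (plane_left_iff ..).2 h1

theorem gaugeLeft_of_right_same {x : Torus L} (h1 : ¬ (x μ - s).val < L / 2)
    (h2 : ¬ (x μ - s + 1).val < L / 2) :
    (plane hL μ s).gaugeLeft σ x μ = -σ (planeSite μ s (x + e μ)) μ := by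
  rw [← plane_left_iff hL] at h1
  rw [← plane_left_add_iff hL] at h2
  rw [Reflection.gaugeLeft, if_neg (fun h => h1 h.1), if_pos ⟨h1, h2⟩, plane_edge_same]

theorem gaugeLeft_of_right_of_ne {ν : Fin 2} (hν : ν ≠ μ) {x : Torus L}
    (h1 : ¬ (x μ - s).val < L / 2) :
    (plane hL μ s).gaugeLeft σ x ν = -σ (planeSite μ s x) ν := by
  rw [← plane_left_iff hL] at h1
  rw [Reflection.gaugeLeft, plane_left_add_of_ne _ _ _ hν, if_neg (fun h => h1 h.1),
    if_pos ⟨h1, h1⟩, plane_edge_of_ne _ _ _ hν]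

theorem gaugeLeft_of_cross {x : Torus L}
    (h : ¬ ((x μ - s).val < L / 2 ↔ (x μ - s + 1).val < L / 2)) :
    (plane hL μ s).gaugeLeft σ x μ = 1 := by
  rw [← plane_left_iff hL, ← plane_left_add_iff hL] at h
  rw [Reflection.gaugeLeft, if_neg, if_neg] <;> tauto

theorem plaquette_of_left {ν : Fin 2} (hν : ν ≠ μ) {x : Torus L}
    (h : (x μ - s).val + 1 < L / 2) :
    plaquette ((plane hL μ s).gaugeLeft σ) μ ν x = plaquette σ μ ν x := by
  have h1 : (x μ - s + 1).val = (x μ - s).val + 1 := val_add_one_of_lt (by omega)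
  rw [plaquette, gaugeLeft_of_left, gaugeLeft_of_left, gaugeLeft_of_left, gaugeLeft_of_left,
    plaquette]
  all_goals
    try simp only [add_e_same, add_e_of_ne _ hν.symm, add_sub_right_comm]
    omega

/-- The two cut edges carry `1`, and the two remaining edges are mirror images of each other with
opposite signs. -/
theorem plaquette_of_cross {ν : Fin 2} (hν : ν ≠ μ) {x : Torus L}
    (h : (x μ - s).val + 1 = L / 2 ∨ (x μ - s).val + 1 = L) :
    plaquette ((plane hL μ s).gaugeLeft σ) μ ν x = -1 := by
  have h2 := two_le hL
  have hcross : ¬ ((x μ - s).val < L / 2 ↔ (x μ - s + 1).val < L / 2) := by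
    rcases h with h | h
    · rw [val_add_one_of_lt (by omega)]; omega
    · rw [add_one_eq_zero h, ZMod.val_zero]; omega
  have hsite : x + e μ = planeSite μ s x :=
    (plane hL μ s).tgt_of_cross (x, μ) fun h' => hcross (by
      rw [← plane_left_iff hL, ← plane_left_add_iff hL, h'])
  rw [plaquette, gaugeLeft_of_cross _ _ _ _ hcross,
    gaugeLeft_of_cross _ _ _ _ (by rwa [add_e_of_ne _ hν.symm])]
  rcases h with h | h
  · rw [gaugeLeft_of_left hL μ s σ (x := x) (ν := ν) (by omega) (fun h' => absurd h' hν),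
      gaugeLeft_of_right_of_ne hL μ s σ hν (x := x + e μ), hsite, planeSite_planeSite]
    · simp
    · rw [add_e_same, add_sub_right_comm, val_add_one_of_lt (by omega)]; omega
  · rw [gaugeLeft_of_left hL μ s σ (x := x + e μ) (ν := ν) ?_ (fun h' => absurd h' hν),
      gaugeLeft_of_right_of_ne hL μ s σ hν (x := x) (by omega), ← hsite]
    · simp
    · rw [add_e_same, add_sub_right_comm, add_one_eq_zero h, ZMod.val_zero]; omega

/-- All four edges are reflected with a minus sign, and four signs cancel. -/
theorem plaquette_of_right {ν : Fin 2} (hν : ν ≠ μ) {x : Torus L}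
    (h : L / 2 ≤ (x μ - s).val) (h' : (x μ - s).val + 1 < L) :
    plaquette ((plane hL μ s).gaugeLeft σ) μ ν x =
      plaquette σ μ ν (planeSite μ s (x + e μ)) := by
  have h1 : (x μ - s + 1).val = (x μ - s).val + 1 := val_add_one_of_lt (by omega)
  rw [plaquette, gaugeLeft_of_right_same, gaugeLeft_of_right_of_ne _ _ _ _ hν,
    gaugeLeft_of_right_same, gaugeLeft_of_right_of_ne _ _ _ _ hν, plaquette, planeSite_add_same,
    add_right_comm, planeSite_add_of_ne hν]
  · have : ∀ a b c d : ℤˣ, -a * -b * -c * -d = a * d * c * b := by decide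
    exact this _ _ _ _
  all_goals
    try simp only [add_e_same, add_e_of_ne _ hν.symm, add_sub_right_comm]
    omega

/-- If all plaquettes on the left have flux `π`, then so do all plaquettes after reflection. -/
theorem plaquette_gaugeLeft {ν : Fin 2} (hν : ν ≠ μ)
    (h : ∀ x : Torus L, (x μ - s).val + 1 < L / 2 → plaquette σ μ ν x = -1) (x : Torus L) :
    plaquette ((plane hL μ s).gaugeLeft σ) μ ν x = -1 := by
  have hlt := ZMod.val_lt (x μ - s)
  rcases lt_trichotomy ((x μ - s).val + 1) (L / 2) with h1 | h1 | h1
  · rw [plaquette_of_left _ _ _ _ hν h1, h x h1]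
  · exact plaquette_of_cross _ _ _ _ hν (Or.inl h1)
  · rcases Nat.lt_or_ge ((x μ - s).val + 1) L with h2 | h2
    · rw [plaquette_of_right _ _ _ _ hν (by omega) h2, h]
      rw [planeSite_same, add_e_same,
        show 2 * s - 1 - (x μ + 1) - s = -1 - (x μ - s + 1) by ring, val_neg_one_sub,
        val_add_one_of_lt h2]
      obtain ⟨m, hm⟩ := hL
      omega
    · exact plaquette_of_cross _ _ _ _ hν (Or.inr (by omega))

/-- The flux along the loops perpendicular to the planes of reflection. -/
def reflectedLoopFlux (L : ℕ) [NeZero L] (s : ZMod L) : ℤˣ :=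
  (-1) ^ (Finset.univ.filter fun k : ZMod L =>
    ¬ (k - s).val < L / 2 ∧ ¬ (k - s + 1).val < L / 2).card

/-- The uncut edges of the loop pair off with their mirror images, each pair contributing `-1`, and
the cut edges contribute `1`. The result no longer depends on `σ`. -/
theorem loopFlux_gaugeLeft :
    loopFlux ((plane hL μ s).gaugeLeft σ) μ = reflectedLoopFlux L s := by
  have hk : ∀ k : ZMod L, (plane hL μ s).gaugeLeft σ (Pi.single μ k) μ =
      (if (k - s).val < L / 2 ∧ (k - s + 1).val < L / 2 then σ (Pi.single μ k) μ else 1) *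
      (if ¬ (k - s).val < L / 2 ∧ ¬ (k - s + 1).val < L / 2 then
        -1 * σ (Pi.single μ (2 * s - 2 - k)) μ else 1) := by
    intro k
    have hx : (Pi.single μ k : Torus L) μ = k := Pi.single_eq_same ..
    by_cases h1 : (k - s).val < L / 2 <;> by_cases h2 : (k - s + 1).val < L / 2
    · rw [gaugeLeft_of_left _ _ _ _ (by rwa [hx]) (fun _ => by rwa [hx])]
      simp [h1, h2]
    · rw [gaugeLeft_of_cross _ _ _ _ (by rw [hx]; tauto)]
      simp [h1, h2]
    · rw [gaugeLeft_of_cross _ _ _ _ (by rw [hx]; tauto)]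
      simp [h1, h2]
    · rw [gaugeLeft_of_right_same _ _ _ _ (by rwa [hx]) (by rwa [hx])]
      have : planeSite μ s (Pi.single μ k + e μ) = Pi.single μ (2 * s - 2 - k) := by
        funext κ
        by_cases hκ : κ = μ
        · subst hκ
          rw [planeSite_same, add_e_same, Pi.single_eq_same, Pi.single_eq_same]
          ring
        · simp [hκ, e_of_ne hκ]
      rw [this]
      simp [h1, h2]
  -- The reflection sends the edge from `k` to `k + 1` to the edge from `2 * s - 2 - k` to `2 * s -
  -- 1 - k`, exchanging left and right as well as the two ends.
  have hflip : ∀ k : ZMod L, ((2 * s - 2 - k - s).val < L / 2 ↔ ¬ (k - s + 1).val < L / 2) ∧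
      ((2 * s - 2 - k - s + 1).val < L / 2 ↔ ¬ (k - s).val < L / 2) := by
    intro k
    have e1 : 2 * s - 2 - k - s = -1 - (k - s + 1) := by ring
    have e2 : 2 * s - 2 - k - s + 1 = -1 - (k - s) := by ring
    have l1 := ZMod.val_lt (k - s + 1)
    have l2 := ZMod.val_lt (k - s)
    rw [e2, e1, val_neg_one_sub, val_neg_one_sub]
    obtain ⟨m, hm⟩ := hL
    omega
  rw [loopFlux, Finset.prod_congr rfl fun k _ => hk k, Finset.prod_mul_distrib,
    ← Finset.prod_filter, ← Finset.prod_filter, Finset.prod_mul_distrib, Finset.prod_const,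
    ← reflectedLoopFlux]
  have hsym : ∏ k : ZMod L with ¬ (k - s).val < L / 2 ∧ ¬ (k - s + 1).val < L / 2,
      σ (Pi.single μ (2 * s - 2 - k)) μ =
      ∏ k : ZMod L with (k - s).val < L / 2 ∧ (k - s + 1).val < L / 2, σ (Pi.single μ k) μ := by
    refine Finset.prod_bij' (fun k _ => 2 * s - 2 - k) (fun k _ => 2 * s - 2 - k) ?_ ?_ ?_ ?_ ?_
    · intro k hk
      rw [Finset.mem_filter] at hk ⊢
      rw [(hflip k).1, (hflip k).2]
      have := Finset.mem_univ (2 * s - 2 - k)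
      tauto
    · intro k hk
      rw [Finset.mem_filter] at hk ⊢
      rw [(hflip k).1, (hflip k).2]
      have := Finset.mem_univ (2 * s - 2 - k)
      tauto
    · intro k _; ring
    · intro k _; ring
    · intro k _; rfl
  rw [hsym, mul_left_comm, Int.units_mul_self, mul_one]

end Fluxes

/-! ### Construction of the optimal flux configuration -/

section Main

variable {L : ℕ} [NeZero L]

theorem exists_isMaximizer_plaquette (hL : Even L) (b : Bool) {s : ℝ} (hs : 0 ≤ s) (k : ℕ)
    (hk : k ≤ L / 2) : ∃ σ : GaugeField L, IsMaximizer b s σ ∧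
      ∀ x : Torus L, (x 0).val < k → plaquette σ 0 1 x = -1 := by
  induction k with
  | zero =>
    obtain ⟨σ, hσ⟩ := exists_isMaximizer (L := L) b s
    exact ⟨σ, hσ, fun x hx => absurd hx (Nat.not_lt_zero _)⟩
  | succ k ih =>
    obtain ⟨σ, hσ, hπ⟩ := ih (by omega)
    -- The left half starting at `r` ends at coordinate `k`: the columns already treated lie inside
    -- it, and column `k` is cut by the plane.
    let r : ZMod L := -((L / 2 - 1 - k : ℕ) : ZMod L)
    refine ⟨(plane hL 0 r).gaugeLeft σ, hσ.gaugeLeft hL hs _, fun x hx => ?_⟩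
    have hval : (x 0 - r).val = (x 0).val + (L / 2 - 1 - k) := by
      have : x 0 - r = (((x 0).val + (L / 2 - 1 - k) : ℕ) : ZMod L) := by
        simp [r]
      rw [this, ZMod.val_cast_of_lt (by omega)]
    rcases Nat.lt_or_ge (x 0).val k with h | h
    · rw [plaquette_of_left _ _ _ _ (by decide) (by omega), hπ x h]
    · exact plaquette_of_cross _ _ _ _ (by decide) (Or.inl (by omega))

/-- The fluxes of the optimal gauge field. -/
def optimalFluxes (L : ℕ) [NeZero L] : (Torus L → ℤˣ) × (Fin 2 → ℤˣ) :=
  (fun _ => -1, fun _ => reflectedLoopFlux L 0)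

theorem exists_isMaximizer_fluxes (hL : Even L) (b : Bool) {s : ℝ} (hs : 0 ≤ s) :
    ∃ σ : GaugeField L, IsMaximizer b s σ ∧ fluxes σ = optimalFluxes L := by
  obtain ⟨σ₀, hσ₀, hπ₀⟩ := exists_isMaximizer_plaquette hL b hs (L / 2) le_rfl
  have hσ₁ := hσ₀.gaugeLeft hL hs (plane hL 0 0)
  have hπ₁ := plaquette_gaugeLeft hL 0 0 σ₀ (ν := 1) (by decide) fun x hx =>
    hπ₀ x (by rw [sub_zero] at hx; omega)
  have hl₁ := loopFlux_gaugeLeft hL 0 0 σ₀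
  generalize (plane hL 0 0).gaugeLeft σ₀ = σ₁ at hσ₁ hπ₁ hl₁
  refine ⟨(plane hL 1 0).gaugeLeft σ₁, hσ₁.gaugeLeft hL hs _, Prod.ext ?_ ?_⟩
  · funext x
    have := plaquette_gaugeLeft hL 1 0 σ₁ (ν := 0) (by decide)
      (fun x _ => by rw [plaquette_comm, hπ₁]) x
    rwa [plaquette_comm] at this
  · funext μ
    have h2 := two_le hL
    fin_cases μ
    · refine Eq.trans ?_ hl₁
      refine Finset.prod_congr rfl fun k _ => ?_
      -- The horizontal loop through the origin lies in the left half of the second reflection, so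
      -- its flux survives.
      refine gaugeLeft_of_left hL 1 0 σ₁ ?_ fun h => ?_
      · simp
        omega
      · exact absurd h (by decide)
    · exact loopFlux_gaugeLeft hL 1 0 σ₁

end Main

end PiFlux

theorem theorem3p1 (L : ℕ) [NeZero L] (hL : Even L) :
    ∃ σπ : PiFlux.GaugeField L, PiFlux.IsPiFlux σπ ∧
      ∀ t β : ℝ, 0 < t → 0 ≤ β →
        IsGreatest (PiFlux.valuesOverFluxes fun σ : PiFlux.GaugeField L => PiFlux.evenZ t β σ)
          (PiFlux.evenZ t β σπ) ∧
        IsGreatest (PiFlux.valuesOverFluxes fun σ : PiFlux.GaugeField L => PiFlux.oddZ t β σ)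
          (PiFlux.oddZ t β σπ) := by
  -- The parity and the amplitude `1` are arbitrary here; only the fluxes of `σπ` are kept.
  obtain ⟨σπ, -, hflux⟩ := PiFlux.exists_isMaximizer_fluxes hL false zero_le_one
  have hmax : ∀ b s, 0 ≤ s → PiFlux.IsMaximizer b s σπ := by
    intro b s hs τ
    obtain ⟨σ, hσ, hσflux⟩ := PiFlux.exists_isMaximizer_fluxes hL b hs
    rw [PiFlux.partition_eq_of_fluxes_eq (hflux.trans hσflux.symm)]
    exact hσ τ
  refine ⟨σπ, fun x => congrFun (congrArg Prod.fst hflux) x, fun t β ht hβ => ?_⟩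
  have hs : 0 ≤ β * t := mul_nonneg hβ ht.le
  refine ⟨⟨⟨_, σπ, rfl, rfl⟩, ?_⟩, ⟨⟨_, σπ, rfl, rfl⟩, ?_⟩⟩
  · rintro _ ⟨_, τ, -, rfl⟩
    simp only [PiFlux.evenZ_eq]
    exact hmax false _ hs τ
  · rintro _ ⟨_, τ, -, rfl⟩
    simp only [PiFlux.oddZ_eq]
    exact hmax true _ hs τ
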